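/- **Proposition (formula for $V^{(q)}$, Cramér–Lundberg).** Let $\lambda,\mu,r>0$, $0<\delta<p$ and $q\ge 0$; if $q=0$, assume moreover $\lambda\ne\mu p$ and $\lambda\neq\mu(p-\delta)$. Let $X_t=pt-\sum_{i=1}^{N_t}U_i$, where $N$ is a homogeneous Poisson process with intensity $\lambda$ and the $U_i$ are i.i.d. exponential random variables with parameter $\mu$, independent of $N$, and let $Y_t=X_t-\delta t$. For a spectrally negative Lévy process with Laplace exponent $\psi$ (for $X$: $\psi(\theta)=\log\mathbb E[e^{\theta X_1}]$, $\theta\ge0$) and $\Phi(q)=\sup\{\theta\ge0:\psi(\theta)=q\}$, the $q$-scale function is the function $\mathbb R\to[0,\infty)$ that vanishes on $(-\infty,0)$, is continuous and strictly increasing on $[0,\infty)$, and has Laplace transform $1/(\psi(\theta)-q)$ for $\theta>\Phi(q)$. Let $W^{(q)}$ and $\mathbb W^{(q)}$ be the $q$-scale functions of $X$ and $Y$. Put $$w^{(q)}(x;a)=\begin{cases}W^{(q)}(x-a),&x<0,\\ W^{(q)}(x-a)+\delta\int_0^x\mathbb W^{(q)}(x-y)\,W^{(q)\prime}(y-a)\,dy,&x\ge0,\end{cases}\qquad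 V^{(q)}(x)=\int_0^\infty w^{(q)}(x;-z)\,\frac zr\,\mathbb P(X_r\in dz).$$ Let $$q^{\pm}=\frac{q+\lambda-\mu p\pm\sqrt{(q+\lambda-\mu p)^2+4pq\mu}}{2p},\qquad A^{\pm}=\frac{\mu+q^{\pm}}{q^{+}-q^{-}},$$ let $q_Y^\pm$, $A_Y^\pm$ be the same expressions with $p-\delta$ in place of $p$, let $\gamma(a,x)=\int_0^x e^{-t}t^{a-1}\,dt$ be the lower incomplete gamma function, and for $L\ge0$ let $$S_1(L)=\sum_{m=0}^\infty\frac{(pr(q^-+\mu))^m}{m!(m+1)!}\,\gamma\bigl(m+1,L(q^++\mu)\bigr)\,[pr(q^++\mu)-(m+1)],$$ $$S_2(L)=\sum_{m=0}^\infty\frac{(pr(q^++\mu))^m}{m!(m+1)!}\,\gamma\bigl(m+1,L(q^-+\mu)\bigr)\,[pr(q^-+\mu)-(m+1)].$$ Then the scale functions exist, with $W^{(q)}(x)=\frac1p(A^+e^{q^+x}-A^-e^{q^-x})$ and $\mathbb W^{(q)}(x)=\frac1{p-\delta}(A_Y^+e^{q_Y^+x}-A_Y^-e^{q_Y^-x})$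 for $x\ge0$; the integrals defining $w^{(q)}(x;-z)$ ($x\ge 0$, $z>0$) and $V^{(q)}(x)$ ($x\in\mathbb R$) exist; all the series here and below converge; and: * for $x>0$, $$V^{(q)}(x)=e^{qr}(p-\delta)\mathbb W^{(q)}(x)-\frac1{\mu\lambda}\Bigl[(q+\lambda)\mathbb W^{(q)}(x)-(p-\delta)\mathbb W^{(q)\prime}(x)\Bigr]\Bigl[(q+\lambda)e^{qr}-pC\Bigr],$$ where $$C=e^{-\lambda r}\Bigl[pW^{(q)\prime}(pr)+A^-q^+e^{q^+pr}S_1(pr)-A^+q^-e^{q^-pr}S_2(pr)+\frac{e^{-\mu pr}}{pr}\sum_{m=0}^\infty\frac{(p\lambda\mu r^2)^{m+1}}{m!(m+1)!}\Bigr];$$ * for $-pr\le x\le0$, $$V^{(q)}(x)=e^{-\lambda r}\Bigl[pW^{(q)}(x+pr)+A^-e^{q^+(x+pr)}S_1(x+pr)-A^+e^{q^-(x+pr)}S_2(x+pr)\Bigr];$$ * for $x<-pr$, $V^{(q)}(x)=0$. -/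

import Mathlib

open MeasureTheory ProbabilityTheory Set Filter Topology
open scoped NNReal Nat

noncomputable section

namespace ParisianRefracted

/-- `N` is a homogeneous Poisson process with intensity `lam` under `P`. -/
structure IsPoissonProcess {Ω : Type*} [MeasurableSpace Ω] (P : Measure Ω) (lam : ℝ)
    (N : ℝ≥0 → Ω → ℕ) : Prop where
  measurable : ∀ t, Measurable (N t)
  zero : ∀ᵐ ω ∂P, N 0 ω = 0
  monotone : ∀ᵐ ω ∂P, Monotone (fun t => N t ω)
  rightContinuous : ∀ᵐ ω ∂P, ∀ t, ContinuousWithinAt (fun s => N s ω) (Ici t) t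
  indepIncrements : HasIndepIncrements N P
  increments : ∀ s t : ℝ≥0, s ≤ t →
    HasLaw (fun ω => N t ω - N s ω) (poissonMeasure (lam * ((t : ℝ) - s)).toNNReal) P

/-- The driving data of the Cramér–Lundberg process with exponential claims: a Poisson process `N`
of intensity `lam`, i.i.d. exponential claims `U i` of parameter `mu`, independent of `N`. -/
structure IsClaimModel {Ω : Type*} [MeasurableSpace Ω] (P : Measure Ω) (lam mu : ℝ)
    (N : ℝ≥0 → Ω → ℕ) (U : ℕ → Ω → ℝ) : Prop where
  poisson : IsPoissonProcess P lam N
  measurable : ∀ i, Measurable (U i)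
  law : ∀ i, HasLaw (U i) (expMeasure mu) P
  iIndep : iIndepFun U P
  indep : IndepFun (fun ω t => N t ω) (fun ω i => U i ω) P

/-- The process `X_t = p t - ∑_{i = 1}^{N_t} U_i` (the claims are indexed from `0` here). -/
def cramerLundberg {Ω : Type*} (p : ℝ) (N : ℝ≥0 → Ω → ℕ) (U : ℕ → Ω → ℝ) (t : ℝ≥0) (ω : Ω) : ℝ :=
  p * t - ∑ i ∈ Finset.range (N t ω), U i ω

/-- The process `Y_t = X_t - δ t`. -/
def subtractDrift {Ω : Type*} (X : ℝ≥0 → Ω → ℝ) (delta : ℝ) (t : ℝ≥0) (ω : Ω) : ℝ :=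
  X t ω - delta * t

/-- The Laplace exponent `ψ(θ) = log E[exp (θ X_1)]`. -/
def laplaceExponent {Ω : Type*} [MeasurableSpace Ω] (P : Measure Ω) (X : ℝ≥0 → Ω → ℝ) (θ : ℝ) : ℝ :=
  cgf (X 1) P θ

/-- The right inverse `Φ(q) = sup {θ ≥ 0 : ψ(θ) = q}`. -/
def rightInverse (ψ : ℝ → ℝ) (q : ℝ) : ℝ :=
  sSup {θ : ℝ | 0 ≤ θ ∧ ψ θ = q}

/-- The characterisation of the `q`-scale function of the spectrally negative Lévy process with
Laplace exponent `ψ`. -/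
structure IsScaleFunction (ψ : ℝ → ℝ) (q : ℝ) (W : ℝ → ℝ) : Prop where
  nonneg : ∀ x, 0 ≤ W x
  eq_zero : ∀ x < 0, W x = 0
  strictMonoOn : StrictMonoOn W (Ici 0)
  continuousOn : ContinuousOn W (Ici 0)
  integrableOn : ∀ θ, rightInverse ψ q < θ →
    IntegrableOn (fun x => Real.exp (-θ * x) * W x) (Ioi 0)
  laplace : ∀ θ, rightInverse ψ q < θ →
    ∫ x in Ioi 0, Real.exp (-θ * x) * W x = 1 / (ψ θ - q)

/-- The `q`-scale function (a function with the above properties, if there is one). -/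
def scaleFunction (ψ : ℝ → ℝ) (q : ℝ) : ℝ → ℝ :=
  Classical.epsilon (IsScaleFunction ψ q)

/-- The scale function `w(x; a)` of the process refracted at `0`, built from the scale functions
`W` of `X` and `WY` of `Y`. -/
def refractedScale (W WY : ℝ → ℝ) (delta x a : ℝ) : ℝ :=
  if x < 0 then W (x - a)
  else W (x - a) + delta * ∫ y in (0 : ℝ)..x, WY (x - y) * deriv W (y - a)

/-- The Parisian refracted scale function
`V(x) = ∫_0^∞ w(x; -z) (z / r) P(X_r ∈ dz)`. -/
def parisianScale {Ω : Type*} [MeasurableSpace Ω] (P : Measure Ω) (X : ℝ≥0 → Ω → ℝ)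
    (delta q : ℝ) (r : ℝ≥0) (x : ℝ) : ℝ :=
  ∫ z in Ioi (0 : ℝ),
    refractedScale (scaleFunction (laplaceExponent P X) q)
      (scaleFunction (laplaceExponent P (subtractDrift X delta)) q) delta x (-z) * (z / r)
    ∂(P.map (X r))

/-- The root `q⁺(q)`. -/
def rootPos (p lam mu q : ℝ) : ℝ :=
  (q + lam - mu * p + Real.sqrt ((q + lam - mu * p) ^ 2 + 4 * p * q * mu)) / (2 * p)

/-- The root `q⁻(q)`. -/
def rootNeg (p lam mu q : ℝ) : ℝ :=
  (q + lam - mu * p - Real.sqrt ((q + lam - mu * p) ^ 2 + 4 * p * q * mu)) / (2 * p)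

/-- The coefficient `A⁺`. -/
def coefPos (p lam mu q : ℝ) : ℝ :=
  (mu + rootPos p lam mu q) / (rootPos p lam mu q - rootNeg p lam mu q)

/-- The coefficient `A⁻`. -/
def coefNeg (p lam mu q : ℝ) : ℝ :=
  (mu + rootNeg p lam mu q) / (rootPos p lam mu q - rootNeg p lam mu q)

/-- The lower incomplete gamma function `γ(a, x) = ∫_0^x e^{-t} t^{a-1} dt`. -/
def lowerGamma (a x : ℝ) : ℝ :=
  ∫ t in (0 : ℝ)..x, Real.exp (-t) * t ^ (a - 1)

/-- The `m`-th term `(p r b)^m / (m! (m+1)!) γ(m+1, L a) [p r a - (m+1)]` of the gamma series. -/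
def gammaTerm (p r a b L : ℝ) (m : ℕ) : ℝ :=
  (p * r * b) ^ m / (m ! * (m + 1)! : ℝ) * lowerGamma (m + 1) (L * a) * (p * r * a - (m + 1))

end ParisianRefracted

end

/-! Conditionally on the number of claims, `X_r` is `p r` (no claim) or `p r` minus a gamma
variable. Hence `ψ(θ) = p θ - lam + lam mu / (θ + mu)` for `θ ≥ 0`, and `ψ(θ) = q` is a quadratic
equation with roots `u = q⁺` and `v = q⁻`. Partial fractions of `1 / (ψ - q)` give `W` as a
combination of two exponentials, and injectivity of the Laplace transform makes it the only scale
function. `Y` is the same model with premium rate `p - delta`.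

For `x ≤ 0`, `w(x; -z) = W(x + z)`, so `V(x)` is an integral of two exponentials against gamma
densities on a bounded interval. This produces the incomplete gamma series (`integral_cutoff_exp`).

For `x > 0`, let `K` and `K_Y` be the convolutions of `W` and `WY` with `exp (-mu x)`. Refraction
separates the variables: `w(x; -z) = (p - delta) WY(x) W(z) - lam mu K_Y(x) K(z)`
(`refractedScale_of_nonneg`), while `lam mu K = (q + lam) W - p W'` (`mul_expScaleConv`). Only the
integrals of `W` and `W'` against `(z / r) P(X_r ∈ dz)` remain. The second is `C`; the first is `exp
(q r)`, an integrated form of Kendall's identity (`integral_cutoff_expScale`). The latter is proved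
by expanding everything into a double series, indexed by the number of claims and the exponent of an
exponential series. Its terms have a ballot-type factor that splits as a difference, and
antisymmetrising in `u + mu`, `v + mu` reassembles a full double exponential series
(`hasSum_ballotTerm_sub`). -/

noncomputable section

namespace ParisianRefracted

/-! ### Moment generating functions and gamma laws. -/

/-- Finite measures on the line whose moment generating functions are finite and equal on a
neighbourhood of `-∞` containing the origin are equal. -/
theorem measure_ext_of_mgf {μ ν : Measure ℝ} [IsFiniteMeasure μ] [IsFiniteMeasure ν] {ε : ℝ}
    (hε : 0 < ε) (hμ : ∀ t < ε, Integrable (fun x => Real.exp (t * x)) μ)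
    (hν : ∀ t < ε, Integrable (fun x => Real.exp (t * x)) ν)
    (h : ∀ t < ε, ∫ x, Real.exp (t * x) ∂μ = ∫ x, Real.exp (t * x) ∂ν) : μ = ν := by
  have hsub : ∀ κ : Measure ℝ, (∀ t < ε, Integrable (fun x => Real.exp (t * x)) κ) →
      AnalyticOnNhd ℂ (complexMGF id κ) {z | z.re < ε} := by
    intro κ hκ z hz
    refine analyticAt_complexMGF (mem_interior.2 ⟨Iio ε, ?_, isOpen_Iio, hz⟩)
    intro t ht
    exact hκ t ht
  have hconv : IsPreconnected {z : ℂ | z.re < ε} :=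
    (convex_halfSpace_re_lt ε).isPreconnected
  -- Identity theorem on a half-plane: agreement at real points near `0` spreads to the imaginary
  -- axis, which lies inside because `ε > 0`, and there the values are the characteristic functions.
  have hEq : Set.EqOn (complexMGF id μ) (complexMGF id ν) {z | z.re < ε} := by
    refine AnalyticOnNhd.eqOn_of_preconnected_of_frequently_eq (hsub μ hμ) (hsub ν hν) hconv
      (z₀ := 0) (by simpa using hε) ?_
    have h_real : ∃ᶠ (x : ℝ) in 𝓝[≠] 0, complexMGF id μ x = complexMGF id ν x := by
      refine Eventually.frequently ?_
      have : ∀ᶠ x : ℝ in 𝓝[≠] 0, x < ε := nhdsWithin_le_nhds (Iio_mem_nhds hε)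
      filter_upwards [this] with x hx
      rw [complexMGF_ofReal, complexMGF_ofReal]
      simp only [mgf, id, h x hx]
    rw [frequently_iff_seq_forall] at h_real ⊢
    obtain ⟨xs, hx_tendsto, hx_eq⟩ := h_real
    refine ⟨fun n => xs n, ?_, fun n => ?_⟩
    · rw [tendsto_nhdsWithin_iff] at hx_tendsto ⊢
      constructor
      · exact Complex.ofReal_zero ▸ (Complex.continuous_ofReal.tendsto 0).comp hx_tendsto.1
      · simpa using hx_tendsto.2
    · simp [hx_eq]
  refine Measure.ext_of_charFun (funext fun t => ?_)
  rw [← complexMGF_id_mul_I, ← complexMGF_id_mul_I]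
  exact hEq (by simpa using hε)

theorem gammaPDFReal_natCast_succ (m : ℕ) (mu : ℝ) {y : ℝ} (hy : 0 < y) :
    gammaPDFReal (m + 1) mu y = mu ^ (m + 1) / m ! * y ^ m * Real.exp (-(mu * y)) := by
  rw [gammaPDFReal, if_pos hy.le, Real.Gamma_nat_eq_factorial, add_sub_cancel_right,
    Real.rpow_natCast]
  norm_cast

theorem integral_gammaMeasure_natCast_succ (m : ℕ) {mu : ℝ} (hmu : 0 < mu) (f : ℝ → ℝ) :
    ∫ y, f y ∂gammaMeasure (m + 1) mu
      = mu ^ (m + 1) / m ! * ∫ y in Ioi 0, y ^ m * Real.exp (-(mu * y)) * f y := by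
  have hm : (0 : ℝ) < m + 1 := by positivity
  have hmeas : Measurable (gammaPDF (m + 1) mu) := (measurable_gammaPDFReal _ _).ennreal_ofReal
  rw [gammaMeasure, integral_withDensity_eq_integral_toReal_smul hmeas
    (ae_of_all _ fun _ => ENNReal.ofReal_lt_top), ← integral_const_mul,
    ← integral_indicator measurableSet_Ioi]
  refine integral_congr_ae ?_
  filter_upwards [compl_mem_ae_iff.2 (measure_singleton (0 : ℝ))] with y hy
  rw [gammaPDF, ENNReal.toReal_ofReal (gammaPDFReal_nonneg hm hmu y), smul_eq_mul]
  rcases lt_or_gt_of_ne (show y ≠ 0 from hy) with h | h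
  · rw [indicator_of_notMem (by simpa using h.le), gammaPDFReal, if_neg (not_le.2 h), zero_mul]
  · rw [indicator_of_mem (by simpa using h), gammaPDFReal_natCast_succ m mu h]
    ring

theorem integral_pow_mul_exp_Ioi (m : ℕ) {c : ℝ} (hc : 0 < c) :
    ∫ y in Ioi 0, y ^ m * Real.exp (-(c * y)) = m ! / c ^ (m + 1) := by
  have h := Real.integral_rpow_mul_exp_neg_mul_Ioi (a := m + 1) (r := c) (by positivity) hc
  rw [Real.Gamma_nat_eq_factorial] at h
  simp only [add_sub_cancel_right, Real.rpow_natCast] at h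
  rw [h]
  norm_cast
  rw [one_div, inv_pow]
  ring

theorem integral_exp_gammaMeasure (m : ℕ) {mu t : ℝ} (hmu : 0 < mu) (ht : t < mu) :
    ∫ y, Real.exp (t * y) ∂gammaMeasure (m + 1) mu = (mu / (mu - t)) ^ (m + 1) := by
  rw [integral_gammaMeasure_natCast_succ m hmu]
  have : ∀ y : ℝ, y ^ m * Real.exp (-(mu * y)) * Real.exp (t * y)
      = y ^ m * Real.exp (-((mu - t) * y)) := by
    intro y
    rw [mul_assoc, ← Real.exp_add]
    ring_nf
  simp_rw [this]
  rw [integral_pow_mul_exp_Ioi m (sub_pos.2 ht), div_pow]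
  have := Nat.cast_ne_zero (R := ℝ).2 (Nat.factorial_ne_zero m)
  field_simp

/-- A non-integrable function has integral `0` by convention, whereas the computed value is
positive. -/
theorem integrable_exp_gammaMeasure (m : ℕ) {mu t : ℝ} (hmu : 0 < mu) (ht : t < mu) :
    Integrable (fun y => Real.exp (t * y)) (gammaMeasure (m + 1) mu) := by
  by_contra h
  have h1 := integral_exp_gammaMeasure m hmu ht
  rw [integral_undef h] at h1
  have := sub_pos.2 ht
  exact absurd h1 (by positivity)

/-! ### The law and the Laplace exponent of the Cramér–Lundberg process. -/

section Model

set_option linter.unusedSectionVars false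

variable {Ω : Type*} [MeasurableSpace Ω] {P : Measure Ω} [IsProbabilityMeasure P]
  {lam mu : ℝ} {N : ℝ≥0 → Ω → ℕ} {U : ℕ → Ω → ℝ}

theorem mgf_claim (hU : HasLaw (U 0) (expMeasure mu) P) (hmu : 0 < mu) {t : ℝ} (ht : t < mu) :
    mgf (U 0) P t = mu / (mu - t) := by
  have h := hU.integral_comp (f := fun y => Real.exp (t * y)) (by fun_prop)
  have h1 := integral_exp_gammaMeasure 0 hmu ht
  simp only [Nat.cast_zero, zero_add, pow_one] at h1
  rw [expMeasure, h1] at h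
  exact h

theorem hasLaw_sum_claims (hU : ∀ i, HasLaw (U i) (expMeasure mu) P)
    (hm : ∀ i, Measurable (U i)) (hind : iIndepFun U P) (hmu : 0 < mu) (m : ℕ) :
    P.map (fun ω => ∑ i ∈ Finset.range (m + 1), U i ω) = gammaMeasure (m + 1) mu := by
  have hmeas : Measurable (fun ω => ∑ i ∈ Finset.range (m + 1), U i ω) :=
    Finset.measurable_sum _ fun i _ => hm i
  have : IsProbabilityMeasure (gammaMeasure (m + 1 : ℝ) mu) :=
    isProbabilityMeasure_gammaMeasure (by positivity) hmu
  have : IsProbabilityMeasure (P.map fun ω => ∑ i ∈ Finset.range (m + 1), U i ω) :=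
    Measure.isProbabilityMeasure_map hmeas.aemeasurable
  have hmgf : ∀ t < mu, ∫ x, Real.exp (t * x)
      ∂(P.map fun ω => ∑ i ∈ Finset.range (m + 1), U i ω) = (mu / (mu - t)) ^ (m + 1) := by
    intro t ht
    rw [integral_map hmeas.aemeasurable (by fun_prop)]
    have h1 := hind.mgf_sum (t := t) hm (Finset.range (m + 1))
    have h2 : ∀ i ∈ Finset.range (m + 1), mgf (U i) P t = mu / (mu - t) := fun i _ =>
      mgf_claim (U := fun _ => U i) (hU i) hmu ht
    rw [Finset.prod_congr rfl h2, Finset.prod_const, Finset.card_range] at h1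
    rw [← h1, mgf]
    simp
  refine measure_ext_of_mgf hmu ?_ (fun t ht => integrable_exp_gammaMeasure m hmu ht) ?_
  · intro t ht
    by_contra h
    have h1 := hmgf t ht
    rw [integral_undef h] at h1
    have := sub_pos.2 ht
    exact absurd h1 (by positivity)
  · intro t ht
    rw [hmgf t ht, integral_exp_gammaMeasure m hmu ht]

theorem claim_nonneg (hU : HasLaw (U 0) (expMeasure mu) P) : ∀ᵐ ω ∂P, 0 ≤ U 0 ω := by
  rw [hU.ae_iff (p := fun x => 0 ≤ x) (measurableSet_setOfPred.1 measurableSet_Ici)]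
  rw [ae_iff]
  have : {a : ℝ | ¬ 0 ≤ a} = Iio 0 := by ext; simp
  rw [this, expMeasure, gammaMeasure, withDensity_apply _ measurableSet_Iio]
  exact lintegral_gammaPDF_of_nonpos le_rfl

theorem measurable_cramerLundberg (hNU : IsClaimModel P lam mu N U) (p : ℝ) (t : ℝ≥0) :
    Measurable (cramerLundberg p N U t) := by
  have h : Measurable (fun x : ℕ × Ω => ∑ i ∈ Finset.range x.1, U i x.2) :=
    measurable_from_prod_countable_right fun n =>
      Finset.measurable_sum (Finset.range n) fun i _ => hNU.measurable i
  exact measurable_const.sub (h.comp ((hNU.poisson.measurable t).prodMk measurable_id))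

theorem cramerLundberg_le (hNU : IsClaimModel P lam mu N U) (p : ℝ) (t : ℝ≥0) :
    ∀ᵐ z ∂P.map (cramerLundberg p N U t), z ≤ p * t := by
  rw [ae_map_iff (measurable_cramerLundberg hNU p t).aemeasurable measurableSet_Iic]
  have h : ∀ᵐ ω ∂P, ∀ i, 0 ≤ U i ω :=
    ae_all_iff.2 fun i => claim_nonneg (U := fun _ => U i) (hNU.law i)
  filter_upwards [h] with ω hω
  exact sub_le_self _ (Finset.sum_nonneg fun i _ => hω i)

theorem measure_poisson_eq (hN : IsPoissonProcess P lam N) (hlam : 0 ≤ lam) (t : ℝ≥0) (k : ℕ) :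
    P {ω | N t ω = k} = ENNReal.ofReal (Real.exp (-(lam * t)) * (lam * t) ^ k / k !) := by
  have h := (hN.increments 0 t (zero_le)).congr (Y := N t) (by
    filter_upwards [hN.zero] with ω hω
    simp [hω])
  have h1 := h.measure_eq (p := fun n => n = k) (measurableSet_singleton k)
  rw [h1, ofPred_eq_eq_singleton, poissonMeasure_singleton]
  have : 0 ≤ lam * t := by positivity
  simp [Real.coe_toNNReal _ this]

/-- Conditioning on the number of claims: the events `N t = k` partition the space, and each is
independent of the claim sizes. -/
theorem map_cramerLundberg (hNU : IsClaimModel P lam mu N U) (hlam : 0 ≤ lam) (p : ℝ) (t : ℝ≥0) :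
    P.map (cramerLundberg p N U t) = Measure.sum fun k : ℕ =>
      ENNReal.ofReal (Real.exp (-(lam * t)) * (lam * t) ^ k / k !) •
        P.map (fun ω => p * t - ∑ i ∈ Finset.range k, U i ω) := by
  have hS : ∀ k, Measurable fun ω => p * t - ∑ i ∈ Finset.range k, U i ω := fun k =>
    measurable_const.sub (Finset.measurable_sum _ fun i _ => hNU.measurable i)
  ext s hs
  rw [Measure.map_apply (measurable_cramerLundberg hNU p t) hs, Measure.sum_apply _ hs]
  have hunion : cramerLundberg p N U t ⁻¹' s
      = ⋃ k, ({ω | N t ω = k} ∩ (fun ω => p * t - ∑ i ∈ Finset.range k, U i ω) ⁻¹' s) := by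
    ext ω
    simp [cramerLundberg]
  rw [hunion, measure_iUnion]
  · refine tsum_congr fun k => ?_
    rw [Measure.smul_apply, Measure.map_apply (hS k) hs, smul_eq_mul,
      ← measure_poisson_eq hNU.poisson hlam t k]
    have hind : IndepFun (N t) (fun ω => p * t - ∑ i ∈ Finset.range k, U i ω) P :=
      hNU.indep.comp (measurable_pi_apply t) (show Measurable
        fun u : ℕ → ℝ => p * t - ∑ i ∈ Finset.range k, u i from
        measurable_const.sub (Finset.measurable_sum _ fun i _ => measurable_pi_apply i))
    exact hind.measure_inter_preimage_eq_mul {k} s (measurableSet_singleton k) hs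
  · intro i j hij
    refine Disjoint.mono inter_subset_left inter_subset_left ?_
    rw [Set.disjoint_left]
    intro ω h1 h2
    exact hij (h1.symm.trans h2)
  · intro k
    exact (hNU.poisson.measurable t (measurableSet_singleton k)).inter (hS k hs)

/-- The expectation of a function of `X_t`: the atom at `p t` and the series of gamma parts. -/
theorem hasSum_integral_cramerLundberg (hNU : IsClaimModel P lam mu N U) (hlam : 0 ≤ lam)
    (hmu : 0 < mu) (p : ℝ) (t : ℝ≥0) {f : ℝ → ℝ} (hf : Measurable f)
    (hfi : Integrable f (P.map (cramerLundberg p N U t))) :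
    HasSum (fun m : ℕ => Real.exp (-(lam * t)) * ((lam * t * mu) ^ (m + 1) / (m ! * (m + 1)!) *
        ∫ y in Ioi 0, y ^ m * Real.exp (-(mu * y)) * f (p * t - y)))
      (∫ z, f z ∂(P.map (cramerLundberg p N U t)) - Real.exp (-(lam * t)) * f (p * t)) := by
  rw [map_cramerLundberg hNU hlam] at hfi ⊢
  have h := hasSum_integral_measure hfi
  -- The term `k = 0` is the atom at `p t`; it is moved to the other side.
  rw [← hasSum_nat_add_iff' 1] at h
  convert! h using 1
  · funext m
    have hS : Measurable fun ω => ∑ i ∈ Finset.range (m + 1), U i ω :=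
      Finset.measurable_sum _ fun i _ => hNU.measurable i
    have h1 : P.map (fun ω => p * t - ∑ i ∈ Finset.range (m + 1), U i ω)
        = (gammaMeasure (m + 1) mu).map (fun y => p * t - y) := by
      rw [← hasLaw_sum_claims hNU.law hNU.measurable hNU.iIndep hmu m,
        Measure.map_map (by fun_prop) hS]
      rfl
    rw [integral_smul_measure, h1, integral_map (by fun_prop) hf.aestronglyMeasurable,
      integral_gammaMeasure_natCast_succ m hmu, ENNReal.toReal_ofReal (by positivity), smul_eq_mul,
      mul_pow]
    ring
  · simp [integral_smul_measure, ENNReal.toReal_ofReal (Real.exp_pos _).le]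

theorem integral_exp_cramerLundberg (hNU : IsClaimModel P lam mu N U) (hlam : 0 ≤ lam)
    (hmu : 0 < mu) (p : ℝ) (t : ℝ≥0) {θ : ℝ} (hθ : 0 ≤ θ) :
    mgf (cramerLundberg p N U t) P θ
      = Real.exp (t * (p * θ - lam + lam * mu / (θ + mu))) := by
  have hmeas := measurable_cramerLundberg hNU p t
  have : IsProbabilityMeasure (P.map (cramerLundberg p N U t)) :=
    Measure.isProbabilityMeasure_map hmeas.aemeasurable
  have hint : Integrable (fun z => Real.exp (θ * z)) (P.map (cramerLundberg p N U t)) := by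
    refine Integrable.of_bound (by fun_prop) (Real.exp (θ * (p * t))) ?_
    filter_upwards [cramerLundberg_le hNU p t] with z hz
    rw [Real.norm_of_nonneg (Real.exp_pos _).le]
    gcongr
  have h := hasSum_integral_cramerLundberg hNU hlam hmu p t (by fun_prop) hint
  rw [integral_map hmeas.aemeasurable (by fun_prop)] at h
  have hθmu : 0 < θ + mu := by positivity
  set s := lam * t * mu / (θ + mu) with hs
  have hterm : ∀ m : ℕ, Real.exp (-(lam * t)) * ((lam * t * mu) ^ (m + 1) / (m ! * (m + 1)!) *
        ∫ y in Ioi 0, y ^ m * Real.exp (-(mu * y)) * Real.exp (θ * (p * t - y)))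
      = Real.exp (-(lam * t)) * Real.exp (θ * (p * t)) * (s ^ (m + 1) / (m + 1)!) := by
    intro m
    have h1 : ∀ y : ℝ, y ^ m * Real.exp (-(mu * y)) * Real.exp (θ * (p * t - y))
        = Real.exp (θ * (p * t)) * (y ^ m * Real.exp (-((θ + mu) * y))) := by
      intro y
      rw [mul_left_comm, mul_assoc, ← Real.exp_add, ← Real.exp_add]
      ring_nf
    simp_rw [h1]
    rw [integral_const_mul, integral_pow_mul_exp_Ioi m hθmu, hs, div_pow]
    have := Nat.cast_ne_zero (R := ℝ).2 (Nat.factorial_ne_zero m)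
    field_simp
  simp_rw [hterm] at h
  have h2 : HasSum (fun m : ℕ => s ^ (m + 1) / (m + 1)!) (Real.exp s - 1) := by
    have := NormedSpace.expSeries_div_hasSum_exp s
    rw [← Real.exp_eq_exp_ℝ] at this
    rw [← hasSum_nat_add_iff' 1] at this
    simpa using this
  have h3 := h.unique (h2.mul_left (Real.exp (-(lam * t)) * Real.exp (θ * (p * t))))
  rw [mgf]
  have h4 : Real.exp (t * (p * θ - lam + lam * mu / (θ + mu)))
      = Real.exp (-(lam * t)) * Real.exp (θ * (p * t)) * Real.exp s := by
    rw [← Real.exp_add, ← Real.exp_add, hs]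
    ring_nf
  rw [h4]
  linarith

theorem laplaceExponent_cramerLundberg (hNU : IsClaimModel P lam mu N U) (hlam : 0 ≤ lam)
    (hmu : 0 < mu) (p : ℝ) {θ : ℝ} (hθ : 0 ≤ θ) :
    laplaceExponent P (cramerLundberg p N U) θ = p * θ - lam + lam * mu / (θ + mu) := by
  rw [laplaceExponent, cgf, integral_exp_cramerLundberg hNU hlam hmu p 1 hθ, Real.log_exp]
  simp

end Model

theorem subtractDrift_cramerLundberg {Ω : Type*} (p delta : ℝ) (N : ℝ≥0 → Ω → ℕ)
    (U : ℕ → Ω → ℝ) :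
    subtractDrift (cramerLundberg p N U) delta = cramerLundberg (p - delta) N U := by
  funext t ω
  simp only [subtractDrift, cramerLundberg]
  ring

/-! ### Roots of `ψ = q` and the explicit scale functions. -/

/-- `u` and `v` are the two roots of `ψ(θ) = q` for `ψ(θ) = p θ - lam + lam mu / (θ + mu)`, with
their signs. -/
structure IsRootPair (p lam mu q u v : ℝ) : Prop where
  p_pos : 0 < p
  lam_pos : 0 < lam
  mu_pos : 0 < mu
  q_nonneg : 0 ≤ q
  neg_mu_lt : -mu < v
  nonpos : v ≤ 0
  nonneg : 0 ≤ u
  lt : v < u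
  sum : p * (u + v) = q + lam - mu * p
  prod : p * (u * v) = -(q * mu)

/-- For `q = 0` the discriminant is `(lam - mu p) ^ 2`, so the condition on `lam` is what keeps the
roots distinct. The signs come from `|B| ≤ D`, and `-mu < v` from `p (u + mu) (v + mu) = lam mu >
0`. -/
theorem isRootPair {p lam mu q : ℝ} (hp : 0 < p) (hlam : 0 < lam) (hmu : 0 < mu) (hq : 0 ≤ q)
    (hq0 : q = 0 → lam ≠ mu * p) :
    IsRootPair p lam mu q (rootPos p lam mu q) (rootNeg p lam mu q) := by
  set B := q + lam - mu * p with hB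
  have hdisc : 0 < B ^ 2 + 4 * p * q * mu := by
    rcases hq.eq_or_lt with h | h
    · have : B ≠ 0 := by
        rw [hB, ← h]
        intro h'
        exact hq0 h.symm (by linarith)
      positivity
    · positivity
  set D := Real.sqrt (B ^ 2 + 4 * p * q * mu) with hD
  have hDpos : 0 < D := Real.sqrt_pos.2 hdisc
  have hDsq : D ^ 2 = B ^ 2 + 4 * p * q * mu := Real.sq_sqrt hdisc.le
  have hu : rootPos p lam mu q = (B + D) / (2 * p) := rfl
  have hv : rootNeg p lam mu q = (B - D) / (2 * p) := rfl
  have habs : |B| ≤ D := Real.abs_le_sqrt (by nlinarith [mul_nonneg (mul_nonneg hp.le hq) hmu.le])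
  have h1 := neg_le_of_abs_le habs
  have h2 := le_of_abs_le habs
  have hsum : p * (rootPos p lam mu q + rootNeg p lam mu q) = q + lam - mu * p := by
    rw [hu, hv, ← hB]
    field_simp
    ring
  have hprod : p * (rootPos p lam mu q * rootNeg p lam mu q) = -(q * mu) := by
    rw [hu, hv]
    field_simp
    linear_combination -hDsq
  have hnonneg : 0 ≤ rootPos p lam mu q := by
    rw [hu]
    exact div_nonneg (by linarith) (by positivity)
  refine ⟨hp, hlam, hmu, hq, ?_, ?_, hnonneg, ?_, hsum, hprod⟩
  · have hpos : 0 < (rootPos p lam mu q + mu) * (p * (rootNeg p lam mu q + mu)) := by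
      have : (rootPos p lam mu q + mu) * (p * (rootNeg p lam mu q + mu)) = lam * mu := by
        linear_combination hprod + mu * hsum
      rw [this]
      positivity
    have := pos_of_mul_pos_right hpos (by positivity)
    have := pos_of_mul_pos_right this hp.le
    linarith
  · rw [hv]
    exact div_nonpos_of_nonpos_of_nonneg (by linarith) (by positivity)
  · rw [hu, hv]
    gcongr
    linarith

/-- The explicit form of the scale function on the half-line, as a function on the line. -/
def expScale (p mu u v x : ℝ) : ℝ :=
  1 / p * ((mu + u) / (u - v) * Real.exp (u * x) - (mu + v) / (u - v) * Real.exp (v * x))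

namespace IsRootPair

variable {p lam mu q u v : ℝ} (h : IsRootPair p lam mu q u v)
include h

theorem sub_pos : 0 < u - v := _root_.sub_pos.2 h.lt

theorem add_mu_pos : 0 < u + mu := by linarith [h.nonneg, h.mu_pos]

theorem add_mu_pos' : 0 < v + mu := by linarith [h.neg_mu_lt]

theorem mul_add_mu : p * ((u + mu) * (v + mu)) = lam * mu := by
  linear_combination h.prod + mu * h.sum

theorem exponent_left : p * u - lam + lam * mu / (u + mu) = q := by
  have := h.add_mu_pos
  field_simp
  linear_combination u * h.sum - h.prod

theorem exponent_right : p * v - lam + lam * mu / (v + mu) = q := by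
  have := h.add_mu_pos'
  field_simp
  linear_combination v * h.sum - h.prod

theorem exponent_sub {θ : ℝ} (hθ : 0 ≤ θ) :
    p * θ - lam + lam * mu / (θ + mu) - q = p * ((θ - u) * (θ - v)) / (θ + mu) := by
  have : 0 < θ + mu := by linarith [h.mu_pos]
  field_simp
  linear_combination θ * h.sum - h.prod

theorem expScale_zero : expScale p mu u v 0 = 1 / p := by
  have := h.sub_pos
  simp only [expScale, mul_zero, Real.exp_zero]
  field_simp
  ring

/-- By the factorisation in `exponent_sub`, `ψ - q` is positive beyond `u`. -/
theorem rightInverse_eq {ψ : ℝ → ℝ}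
    (hψ : ∀ θ, 0 ≤ θ → ψ θ = p * θ - lam + lam * mu / (θ + mu)) : rightInverse ψ q = u := by
  refine IsGreatest.csSup_eq ⟨⟨h.nonneg, ?_⟩, ?_⟩
  · rw [hψ u h.nonneg, h.exponent_left]
  · rintro θ ⟨hθ, hθq⟩
    by_contra hlt
    push Not at hlt
    have h1 := h.exponent_sub hθ
    rw [← hψ θ hθ, hθq, sub_self] at h1
    have : 0 < p * ((θ - u) * (θ - v)) / (θ + mu) :=
      div_pos (mul_pos h.p_pos (mul_pos (by linarith) (by linarith [h.lt])))
        (by linarith [h.mu_pos])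
    linarith

omit h in
theorem hasDerivAt_expScale (x : ℝ) : HasDerivAt (expScale p mu u v)
    (1 / p * ((mu + u) / (u - v) * (Real.exp (u * x) * u)
      - (mu + v) / (u - v) * (Real.exp (v * x) * v))) x := by
  have h1 : ∀ c : ℝ, HasDerivAt (fun x => Real.exp (c * x)) (Real.exp (c * x) * c) x := fun c => by
    simpa using ((hasDerivAt_id x).const_mul c).exp
  exact (((h1 u).const_mul _).sub ((h1 v).const_mul _)).const_mul _

omit h in
theorem continuous_expScale : Continuous (expScale p mu u v) := by
  unfold expScale
  fun_prop

theorem strictMono_expScale : StrictMono (expScale p mu u v) := by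
  refine strictMono_of_deriv_pos fun x => ?_
  rw [(hasDerivAt_expScale x).deriv]
  have hs := h.sub_pos
  have hu : 0 < (mu + u) / (u - v) := div_pos (by linarith [h.add_mu_pos]) hs
  have hv : 0 < (mu + v) / (u - v) := div_pos (by linarith [h.add_mu_pos']) hs
  refine mul_pos (one_div_pos.2 h.p_pos) ?_
  have eu := Real.exp_pos (u * x)
  have ev := Real.exp_pos (v * x)
  rcases h.nonneg.eq_or_lt with h0 | h0
  · have hv0 : v < 0 := by linarith [h.lt]
    have : 0 < (mu + v) / (u - v) * (Real.exp (v * x) * -v) :=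
      mul_pos hv (mul_pos ev (by linarith))
    rw [← h0]
    rw [← h0] at this
    linarith
  · have h1 : 0 < (mu + u) / (u - v) * (Real.exp (u * x) * u) := by positivity
    have h2 : 0 ≤ (mu + v) / (u - v) * (Real.exp (v * x) * -v) :=
      mul_nonneg hv.le (mul_nonneg ev.le (by linarith [h.nonpos]))
    linarith

/-- The Laplace transform is the partial fraction decomposition of `(θ + mu) / (p (θ - u) (θ - v))`.
-/
theorem isScaleFunction {ψ : ℝ → ℝ}
    (hψ : ∀ θ, 0 ≤ θ → ψ θ = p * θ - lam + lam * mu / (θ + mu)) :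
    IsScaleFunction ψ q (fun x => if x < 0 then 0 else expScale p mu u v x) := by
  have hIci : EqOn (fun x => if x < 0 then 0 else expScale p mu u v x) (expScale p mu u v)
      (Ici 0) := fun x hx => if_neg (not_lt.2 hx)
  have hexp : ∀ θ, u < θ → ∀ c, c ≤ u →
      IntegrableOn (fun x => Real.exp ((c - θ) * x)) (Ioi 0) ∧
      ∫ x in Ioi 0, Real.exp ((c - θ) * x) = 1 / (θ - c) := by
    intro θ hθ c hc
    refine ⟨integrableOn_exp_mul_Ioi (by linarith) 0, ?_⟩
    rw [integral_exp_mul_Ioi (by linarith) 0, mul_zero, Real.exp_zero, ← neg_sub θ c, div_neg,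
      neg_div, neg_neg]
  have hform : ∀ θ, EqOn (fun x => Real.exp (-θ * x) * if x < 0 then 0 else expScale p mu u v x)
      (fun x => 1 / p * ((mu + u) / (u - v) * Real.exp ((u - θ) * x)
        - (mu + v) / (u - v) * Real.exp ((v - θ) * x))) (Ioi 0) := by
    intro θ x hx
    simp only [if_neg (not_lt.2 (le_of_lt (mem_Ioi.1 hx))), expScale]
    rw [show (u - θ) * x = -θ * x + u * x by ring, show (v - θ) * x = -θ * x + v * x by ring,
      Real.exp_add, Real.exp_add]
    ring
  refine ⟨fun x => ?_, fun x hx => if_pos hx, ?_, ?_, ?_, ?_⟩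
  · split_ifs with hx
    · exact le_rfl
    · have := h.strictMono_expScale.monotone (not_lt.1 hx)
      rw [h.expScale_zero] at this
      exact (one_div_pos.2 h.p_pos).le.trans this
  · exact (h.strictMono_expScale.strictMonoOn _).congr hIci.symm
  · exact continuous_expScale.continuousOn.congr hIci
  · intro θ hθ
    rw [h.rightInverse_eq hψ] at hθ
    rw [integrableOn_congr_fun (hform θ) measurableSet_Ioi]
    exact ((((hexp θ hθ u le_rfl).1).const_mul _).sub
      (((hexp θ hθ v h.lt.le).1).const_mul _)).const_mul _
  · intro θ hθ
    rw [h.rightInverse_eq hψ] at hθ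
    rw [setIntegral_congr_fun measurableSet_Ioi (hform θ), integral_const_mul,
      integral_sub (((hexp θ hθ u le_rfl).1).const_mul _)
        (((hexp θ hθ v h.lt.le).1).const_mul _), integral_const_mul, integral_const_mul,
      (hexp θ hθ u le_rfl).2, (hexp θ hθ v h.lt.le).2]
    have hθ0 : 0 ≤ θ := h.nonneg.trans hθ.le
    rw [hψ θ hθ0, h.exponent_sub hθ0]
    have h1 : 0 < θ - u := by linarith
    have h2 : 0 < θ - v := by linarith [h.lt]
    have h3 : 0 < θ + mu := by linarith [h.mu_pos]
    have h4 := h.sub_pos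
    have h5 := h.p_pos
    field_simp
    ring

end IsRootPair

/-- Exponentially tilted, both functions become densities of finite measures with equal moment
generating functions. Equality almost everywhere then extends to the closed half-line by continuity.
-/
theorem IsScaleFunction.eq {ψ : ℝ → ℝ} {q : ℝ} {W₁ W₂ : ℝ → ℝ} (h₁ : IsScaleFunction ψ q W₁)
    (h₂ : IsScaleFunction ψ q W₂) : W₁ = W₂ := by
  set c := rightInverse ψ q
  -- The tilt `c + 1` lies one unit above the abscissa `c`, so the generating functions are finite
  -- for all `t < 1`, a half-line containing `0` in its interior.
  set g : (ℝ → ℝ) → ℝ → ENNReal := fun W x => ENNReal.ofReal (Real.exp (-(c + 1) * x) * W x)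
    with hg
  have hnn : ∀ {W}, IsScaleFunction ψ q W → ∀ x, 0 ≤ Real.exp (-(c + 1) * x) * W x :=
    fun hW x => mul_nonneg (Real.exp_pos _).le (hW.nonneg x)
  have hint : ∀ {W}, IsScaleFunction ψ q W →
      IntegrableOn (fun x => Real.exp (-(c + 1) * x) * W x) (Ioi 0) :=
    fun hW => hW.integrableOn (c + 1) (by simp [c])
  have hmeas : ∀ {W}, IsScaleFunction ψ q W → AEMeasurable (g W) (volume.restrict (Ioi 0)) :=
    fun hW => (hint hW).aestronglyMeasurable.aemeasurable.ennreal_ofReal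
  have hfin : ∀ {W}, IsScaleFunction ψ q W → ∫⁻ x in Ioi 0, g W x ≠ ⊤ := fun hW =>
    (hint hW).lintegral_lt_top.ne
  have hprod : ∀ {W}, IsScaleFunction ψ q W → ∀ t : ℝ,
      (fun x => (g W x).toReal • Real.exp (t * x))
        = fun x => Real.exp (-(c + 1 - t) * x) * W x := by
    intro W hW t
    funext x
    rw [hg, ENNReal.toReal_ofReal (hnn hW x), smul_eq_mul, mul_right_comm, ← Real.exp_add]
    ring_nf
  have hI : ∀ {W}, IsScaleFunction ψ q W → ∀ t < 1, Integrable (fun x => Real.exp (t * x))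
      ((volume.restrict (Ioi 0)).withDensity (g W)) := by
    intro W hW t ht
    rw [integrable_withDensity_iff_integrable_smul₀' (hmeas hW)
      (ae_of_all _ fun _ => ENNReal.ofReal_lt_top), hprod hW t]
    exact hW.integrableOn _ (by linarith)
  have hE : ∀ {W}, IsScaleFunction ψ q W → ∀ t < 1, ∫ x, Real.exp (t * x)
      ∂((volume.restrict (Ioi 0)).withDensity (g W)) = 1 / (ψ (c + 1 - t) - q) := by
    intro W hW t ht
    rw [integral_withDensity_eq_integral_toReal_smul₀ (hmeas hW)
      (ae_of_all _ fun _ => ENNReal.ofReal_lt_top), hprod hW t]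
    exact hW.laplace _ (by linarith)
  have : IsFiniteMeasure ((volume.restrict (Ioi 0)).withDensity (g W₁)) :=
    isFiniteMeasure_withDensity (hfin h₁)
  have : IsFiniteMeasure ((volume.restrict (Ioi 0)).withDensity (g W₂)) :=
    isFiniteMeasure_withDensity (hfin h₂)
  have heq := measure_ext_of_mgf one_pos (hI h₁) (hI h₂)
    (fun t ht => (hE h₁ t ht).trans (hE h₂ t ht).symm)
  rw [withDensity_eq_iff (hmeas h₁) (hmeas h₂) (hfin h₁)] at heq
  have hae : W₁ =ᵐ[volume.restrict (Ioi 0)] W₂ := by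
    filter_upwards [heq] with x hx
    have := (ENNReal.ofReal_eq_ofReal_iff (hnn h₁ x) (hnn h₂ x)).1 hx
    exact mul_left_cancel₀ (Real.exp_pos _).ne' this
  have hIoi : EqOn W₁ W₂ (Ioi 0) := Measure.eqOn_open_of_ae_eq hae isOpen_Ioi
    (h₁.continuousOn.mono Ioi_subset_Ici_self) (h₂.continuousOn.mono Ioi_subset_Ici_self)
  have hIci : EqOn W₁ W₂ (Ici 0) := hIoi.of_subset_closure h₁.continuousOn h₂.continuousOn
    Ioi_subset_Ici_self (closure_Ioi (0 : ℝ)).ge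
  funext x
  rcases lt_or_ge x 0 with hx | hx
  · rw [h₁.eq_zero x hx, h₂.eq_zero x hx]
  · exact hIci hx

theorem IsRootPair.scaleFunction_eq {p lam mu q u v : ℝ} (h : IsRootPair p lam mu q u v)
    {ψ : ℝ → ℝ} (hψ : ∀ θ, 0 ≤ θ → ψ θ = p * θ - lam + lam * mu / (θ + mu)) :
    scaleFunction ψ q = fun x => if x < 0 then 0 else expScale p mu u v x :=
  (Classical.epsilon_spec ⟨_, h.isScaleFunction hψ⟩ :
    IsScaleFunction ψ q (scaleFunction ψ q)).eq (h.isScaleFunction hψ)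

/-! ### Incomplete gamma integrals and convergence of the series. -/

theorem integral_pow_mul_exp_eq_lowerGamma (m : ℕ) {a : ℝ} (ha : 0 < a) (L : ℝ) :
    ∫ y in (0 : ℝ)..L, y ^ m * Real.exp (-(a * y)) = lowerGamma (m + 1) (L * a) / a ^ (m + 1) := by
  have h := intervalIntegral.mul_integral_comp_mul_left
    (f := fun s : ℝ => Real.exp (-s) * s ^ ((m : ℝ) + 1 - 1)) (a := 0) (b := L) (c := a)
  rw [mul_zero, mul_comm a L] at h
  rw [lowerGamma, ← h, ← intervalIntegral.integral_const_mul, ← intervalIntegral.integral_div]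
  refine intervalIntegral.integral_congr fun y _ => ?_
  simp only [add_sub_cancel_right, Real.rpow_natCast, mul_pow, pow_succ]
  field_simp

/-- Integration by parts lowers the moment of order `m + 1` to that of order `m`. The first summand
becomes a `gammaTerm`, the boundary term a term of the Bessel-type series. -/
theorem integral_pow_mul_exp_mul_sub (m : ℕ) {a : ℝ} (ha : 0 < a) (L t : ℝ) :
    ∫ y in (0 : ℝ)..L, y ^ m * Real.exp (-(a * y)) * (t - y)
      = ((t * a - (m + 1)) * lowerGamma (m + 1) (L * a)
          + (L * a) ^ (m + 1) * Real.exp (-(a * L))) / a ^ (m + 2) := by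
  have hd : ∀ y ∈ uIcc 0 L, HasDerivAt (fun y : ℝ => y ^ (m + 1) * Real.exp (-(a * y)))
      ((m + 1) * (y ^ m * Real.exp (-(a * y))) - a * (y ^ (m + 1) * Real.exp (-(a * y)))) y := by
    intro y _
    have h1 : HasDerivAt (fun y : ℝ => Real.exp (-(a * y))) (Real.exp (-(a * y)) * -a) y := by
      simpa using ((hasDerivAt_id y).const_mul a).neg.exp
    have h2 := (hasDerivAt_pow (m + 1) y).mul h1
    convert! h2 using 1
    push_cast
    ring
  have hi : ∀ k : ℕ, IntervalIntegrable (fun y : ℝ => y ^ k * Real.exp (-(a * y))) volume 0 L :=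
    fun k => Continuous.intervalIntegrable (by fun_prop) _ _
  have h3 := intervalIntegral.integral_eq_sub_of_hasDerivAt hd
    (((hi m).const_mul _).sub ((hi (m + 1)).const_mul _))
  rw [intervalIntegral.integral_sub ((hi m).const_mul _) ((hi (m + 1)).const_mul _),
    intervalIntegral.integral_const_mul, intervalIntegral.integral_const_mul] at h3
  have h4 : ∫ y in (0 : ℝ)..L, y ^ m * Real.exp (-(a * y)) * (t - y)
      = t * (∫ y in (0 : ℝ)..L, y ^ m * Real.exp (-(a * y)))
        - ∫ y in (0 : ℝ)..L, y ^ (m + 1) * Real.exp (-(a * y)) := by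
    rw [← intervalIntegral.integral_const_mul,
      ← intervalIntegral.integral_sub ((hi m).const_mul _) (hi (m + 1))]
    refine intervalIntegral.integral_congr fun y _ => ?_
    ring
  have h5 := integral_pow_mul_exp_eq_lowerGamma m ha L
  have h6 : lowerGamma (m + 1) (L * a)
      = a ^ (m + 1) * ∫ y in (0 : ℝ)..L, y ^ m * Real.exp (-(a * y)) := by
    rw [h5]
    field_simp
  rw [h4, h6, eq_div_iff (by positivity), mul_pow]
  simp only [ne_eq, Nat.add_eq_zero_iff, one_ne_zero, and_false, not_false_eq_true, zero_pow,
    zero_mul, sub_zero] at h3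
  linear_combination (a ^ (m + 1)) * h3

theorem lowerGamma_nonneg (m : ℕ) {x : ℝ} (hx : 0 ≤ x) : 0 ≤ lowerGamma (m + 1) x :=
  intervalIntegral.integral_nonneg hx fun _ ht =>
    mul_nonneg (Real.exp_pos _).le (Real.rpow_nonneg ht.1 _)

theorem lowerGamma_le (m : ℕ) {x : ℝ} (hx : 0 ≤ x) : lowerGamma (m + 1) x ≤ x ^ (m + 1) := by
  have h : lowerGamma (m + 1) x = ∫ t in (0 : ℝ)..x, Real.exp (-t) * t ^ m := by
    simp only [lowerGamma, add_sub_cancel_right, Real.rpow_natCast]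
  have h1 : ∫ t in (0 : ℝ)..x, Real.exp (-t) * t ^ m ≤ ∫ _ in (0 : ℝ)..x, x ^ m := by
    refine intervalIntegral.integral_mono_on hx
      (Continuous.intervalIntegrable (by fun_prop) _ _) (by simp) fun t ht => ?_
    have h2 : Real.exp (-t) ≤ 1 := Real.exp_le_one_iff.2 (by linarith [ht.1])
    have h3 : t ^ m ≤ x ^ m := pow_le_pow_left₀ ht.1 ht.2 m
    calc Real.exp (-t) * t ^ m ≤ 1 * x ^ m :=
          mul_le_mul h2 h3 (pow_nonneg ht.1 m) zero_le_one
      _ = x ^ m := one_mul _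
  rw [h]
  refine h1.trans_eq ?_
  rw [intervalIntegral.integral_const, sub_zero, smul_eq_mul, pow_succ']

/-- Since `γ(m+1, x) ≤ x ^ (m+1)` and `(m+1)!` absorbs the linear growth of the last factor, an
exponential series dominates. -/
theorem summable_gammaTerm (p r b : ℝ) {a L : ℝ} (ha : 0 ≤ a) (hL : 0 ≤ L) :
    Summable (gammaTerm p r a b L) := by
  have hx : 0 ≤ L * a := mul_nonneg hL ha
  have hs : Summable fun m : ℕ => (|p * r * a| + 1) * (L * a) *
      ((|p * r * b| * (L * a)) ^ m / m !) :=
    (Real.summable_pow_div_factorial _).mul_left _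
  refine Summable.of_norm_bounded hs fun m => ?_
  have h1 : |lowerGamma (m + 1) (L * a)| ≤ (L * a) ^ (m + 1) := by
    rw [abs_of_nonneg (lowerGamma_nonneg m hx)]
    exact lowerGamma_le m hx
  have h2 : |p * r * a - (m + 1)| ≤ (|p * r * a| + 1) * (m + 1) := by
    have hm : (0 : ℝ) ≤ m := Nat.cast_nonneg m
    have h3 : |((m : ℝ) + 1)| = m + 1 := abs_of_nonneg (by positivity)
    have := abs_sub (p * r * a) (m + 1)
    have := mul_nonneg (abs_nonneg (p * r * a)) hm
    linarith
  have hm1 : (1 : ℝ) ≤ m ! := by exact_mod_cast Nat.factorial_pos m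
  have hf : ((m + 1)! : ℝ) = (m + 1) * m ! := by
    rw [Nat.factorial_succ]
    push_cast
    ring
  have h4 : (|p * r * b| ^ m / (m ! * (m + 1)! : ℝ)) * (m + 1)
      ≤ |p * r * b| ^ m / m ! := by
    rw [hf, div_mul_eq_mul_div, div_le_div_iff₀ (by positivity) (by positivity)]
    have : 0 ≤ |p * r * b| ^ m * (m + 1) * (m ! : ℝ) * ((m ! : ℝ) - 1) := by
      have : (0 : ℝ) ≤ (m ! : ℝ) - 1 := by linarith
      positivity
    linarith
  rw [gammaTerm, Real.norm_eq_abs, abs_mul, abs_mul, abs_div, abs_pow,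
    abs_of_pos (show (0 : ℝ) < m ! * (m + 1)! by positivity)]
  calc |p * r * b| ^ m / (m ! * (m + 1)! : ℝ) * |lowerGamma (m + 1) (L * a)|
        * |p * r * a - (m + 1)|
      ≤ |p * r * b| ^ m / (m ! * (m + 1)! : ℝ) * (L * a) ^ (m + 1)
        * ((|p * r * a| + 1) * (m + 1)) := by gcongr
    _ = (|p * r * a| + 1) * (L * a) ^ (m + 1)
        * ((|p * r * b| ^ m / (m ! * (m + 1)! : ℝ)) * (m + 1)) := by ring
    _ ≤ (|p * r * a| + 1) * (L * a) ^ (m + 1) * (|p * r * b| ^ m / m !) := by gcongr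
    _ = _ := by
      rw [mul_pow]
      ring

theorem summable_besselTerm (x : ℝ) :
    Summable fun m : ℕ => x ^ (m + 1) / (m ! * (m + 1)! : ℝ) := by
  refine Summable.of_norm_bounded ((Real.summable_pow_div_factorial |x|).mul_left |x|) fun m => ?_
  rw [norm_div, norm_pow, Real.norm_eq_abs,
    Real.norm_of_nonneg (show (0 : ℝ) ≤ m ! * (m + 1)! by positivity), pow_succ', ← mul_div_assoc]
  have : (1 : ℝ) ≤ (m + 1)! := by exact_mod_cast Nat.factorial_pos (m + 1)
  exact div_le_div_of_nonneg_left (by positivity) (by positivity)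
    (le_mul_of_one_le_right (by positivity) this)

/-! ### Integrals of cut-off functions against the law of `X_r`. -/

section Model

variable {Ω : Type*} [MeasurableSpace Ω] {P : Measure Ω} [IsProbabilityMeasure P]
  {lam mu : ℝ} {N : ℝ≥0 → Ω → ℕ} {U : ℕ → Ω → ℝ} {p : ℝ} {r : ℝ≥0}

/-- The integrand of the Kendall-type functional: a function `g` cut off at the level
`p r - L`, weighted by `z / r`. -/
def cutoff (p r L : ℝ) (g : ℝ → ℝ) (z : ℝ) : ℝ :=
  (if z - p * r + L < 0 then 0 else g (z - p * r + L)) * (z / r)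

theorem measurable_cutoff (p r L : ℝ) {g : ℝ → ℝ} (hg : Continuous g) :
    Measurable (cutoff p r L g) := by
  refine Measurable.mul ?_ (by fun_prop)
  refine Measurable.ite (measurableSet_lt (by fun_prop) (by fun_prop)) measurable_const ?_
  exact hg.measurable.comp (by fun_prop)

theorem integrableOn_cutoff (hNU : IsClaimModel P lam mu N U) (p L : ℝ) (r : ℝ≥0) {g : ℝ → ℝ}
    (hg : Continuous g) :
    IntegrableOn (cutoff p r L g) (Ioi 0) (P.map (cramerLundberg p N U r)) := by
  have : IsProbabilityMeasure (P.map (cramerLundberg p N U r)) :=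
    Measure.isProbabilityMeasure_map (measurable_cramerLundberg hNU p r).aemeasurable
  -- Almost surely `z ≤ p r`, so `g` is only evaluated on `[0, L]`. This interval is empty for `L <
  -- 0`, hence the bound `max K 0` below.
  obtain ⟨K, hK⟩ := (isCompact_Icc (a := (0 : ℝ)) (b := L)).exists_bound_of_continuousOn
    hg.continuousOn
  refine Integrable.of_bound (measurable_cutoff p r L hg).aestronglyMeasurable
    (max K 0 * (p * r / r)) ?_
  have h1 := ae_restrict_of_ae (s := Ioi (0 : ℝ)) (cramerLundberg_le hNU p r)
  filter_upwards [h1, ae_restrict_mem measurableSet_Ioi] with z hz hz0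
  have hz0 : 0 < z := hz0
  rw [cutoff, norm_mul, Real.norm_of_nonneg (div_nonneg hz0.le r.coe_nonneg)]
  refine mul_le_mul ?_ (div_le_div_of_nonneg_right hz r.coe_nonneg) (div_nonneg hz0.le r.coe_nonneg) (le_max_right _ _)
  split_ifs with h
  · simp
  · exact (hK _ ⟨not_lt.1 h, by linarith⟩).trans (le_max_left _ _)

/-- The integral of a cut-off function against the law of `X_r`, as the sum of the contributions
of the numbers of claims. -/
theorem hasSum_integral_cutoff (hNU : IsClaimModel P lam mu N U) (hlam : 0 ≤ lam) (hmu : 0 < mu)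
    (hp : 0 < p) (hr : 0 < r) {L : ℝ} (hL : 0 ≤ L) (hLp : L ≤ p * r) {g : ℝ → ℝ}
    (hg : Continuous g) :
    HasSum (fun m : ℕ => Real.exp (-(lam * r)) * ((lam * r * mu) ^ (m + 1) / (m ! * (m + 1)!) *
        ∫ y in (0 : ℝ)..L, y ^ m * Real.exp (-(mu * y)) * (g (L - y) * ((p * r - y) / r))))
      (∫ z in Ioi 0, cutoff p r L g z ∂(P.map (cramerLundberg p N U r))
        - Real.exp (-(lam * r)) * (p * g L)) := by
  have hr' : (0 : ℝ) < r := hr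
  have hpr : 0 < p * r := mul_pos hp hr'
  have h := hasSum_integral_cramerLundberg hNU hlam hmu p r
    ((measurable_cutoff p r L hg).indicator measurableSet_Ioi)
    ((integrable_indicator_iff measurableSet_Ioi).2 (integrableOn_cutoff hNU p L r hg))
  rw [integral_indicator measurableSet_Ioi] at h
  convert! h using 1
  · funext m
    congr 2
    rw [intervalIntegral.integral_of_le hL, ← integral_indicator measurableSet_Ioc,
      ← integral_indicator measurableSet_Ioi]
    congr 1
    funext y
    by_cases hy : 0 < y
    · rw [indicator_of_mem (show y ∈ Ioi (0 : ℝ) from hy)]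
      by_cases hyL : y ≤ L
      · rw [indicator_of_mem (show y ∈ Ioc 0 L from ⟨hy, hyL⟩)]
        -- At `y = p r` the point `z = 0` is outside the domain of integration, but the weight `z /
        -- r` vanishes there anyway.
        rcases (hyL.trans hLp).eq_or_lt with hy1 | hy1
        · rw [hy1]
          simp
        · rw [indicator_of_mem (show p * r - y ∈ Ioi (0 : ℝ) from sub_pos.2 hy1), cutoff,
            if_neg (by linarith)]
          ring_nf
      · rw [indicator_of_notMem (show y ∉ Ioc 0 L from fun h => hyL h.2)]
        have : cutoff p r L g (p * r - y) = 0 := by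
          rw [cutoff, if_pos (by linarith), zero_mul]
        rw [indicator_apply, this, ite_self, mul_zero]
    · rw [indicator_of_notMem (show y ∉ Ioc 0 L from fun h => hy h.1),
        indicator_of_notMem (show y ∉ Ioi (0 : ℝ) from hy)]
  · rw [indicator_of_mem (show p * r ∈ Ioi (0 : ℝ) from hpr), cutoff, if_neg (by linarith)]
    congr 2
    rw [sub_self, zero_add]
    field_simp

/-- When `θ` is one root, `b` is the other root plus `mu`. Writing `lam mu = p (θ + mu) b` cancels
all but one power of `θ + mu` left in the denominator by the gamma integrals. -/
theorem integral_cutoff_exp (hNU : IsClaimModel P lam mu N U) (hlam : 0 < lam) (hmu : 0 < mu)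
    (hp : 0 < p) (hr : 0 < r) {L : ℝ} (hL : 0 ≤ L) (hLp : L ≤ p * r) {θ b : ℝ}
    (ha : 0 < θ + mu) (hab : p * ((θ + mu) * b) = lam * mu) :
    ∫ z in Ioi 0, cutoff p r L (fun x => Real.exp (θ * x)) z ∂(P.map (cramerLundberg p N U r))
      = Real.exp (-(lam * r)) * (p * Real.exp (θ * L)
        + p * b / (θ + mu) * Real.exp (θ * L) * ∑' m, gammaTerm p r (θ + mu) b L m
        + Real.exp (-(mu * L)) / (r * (θ + mu)) *
          ∑' m : ℕ, (r * L * (lam * mu)) ^ (m + 1) / (m ! * (m + 1)! : ℝ)) := by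
  have hr' : (0 : ℝ) < r := hr
  have h := hasSum_integral_cutoff hNU hlam.le hmu hp hr hL hLp
    (g := fun x => Real.exp (θ * x)) (by fun_prop)
  have h1 := (((summable_gammaTerm p r b ha.le hL).hasSum.mul_left
    (p * b / (θ + mu) * Real.exp (θ * L))).add
    ((summable_besselTerm (r * L * (lam * mu))).hasSum.mul_left
      (Real.exp (-(mu * L)) / (r * (θ + mu))))).mul_left (Real.exp (-(lam * r)))
  have h2 := h.unique (h1.congr_fun ?_)
  · linarith
  · intro m
    have h3 : ∫ y in (0 : ℝ)..L, y ^ m * Real.exp (-(mu * y)) *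
          (Real.exp (θ * (L - y)) * ((p * r - y) / r))
        = Real.exp (θ * L) / r *
          ∫ y in (0 : ℝ)..L, y ^ m * Real.exp (-((θ + mu) * y)) * (p * r - y) := by
      rw [← intervalIntegral.integral_const_mul]
      refine intervalIntegral.integral_congr fun y _ => ?_
      have : Real.exp (-(mu * y)) * Real.exp (θ * (L - y))
          = Real.exp (θ * L) * Real.exp (-((θ + mu) * y)) := by
        rw [← Real.exp_add, ← Real.exp_add]
        ring_nf
      linear_combination (y ^ m * ((p * r - y) / r)) * this
    have h4 : Real.exp (-(mu * L)) = Real.exp (θ * L) * Real.exp (-((θ + mu) * L)) := by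
      rw [← Real.exp_add]
      ring_nf
    rw [h3, integral_pow_mul_exp_mul_sub m ha, gammaTerm, h4]
    set a := θ + mu
    rw [show lam * r * mu = p * r * b * a by linear_combination (-(r : ℝ)) * hab,
      show r * L * (lam * mu) = p * r * b * (L * a) by linear_combination (-(r : ℝ) * L) * hab,
      mul_pow (p * r * b) a, mul_pow (p * r * b) (L * a), pow_succ a (m + 1), pow_succ (p * r * b)]
    field_simp

end Model

/-! ### The ballot series and Kendall's identity. -/

theorem integral_pow_mul_sub_pow (m : ℕ) : ∀ (k : ℕ) (t : ℝ),
    ∫ y in (0 : ℝ)..t, y ^ m * (t - y) ^ k = m ! * k ! / (m + k + 1)! * t ^ (m + k + 1) := by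
  induction m with
  | zero =>
    intro k t
    have h := intervalIntegral.integral_comp_sub_left (a := 0) (b := t) (fun y : ℝ => y ^ k) t
    simp only [pow_zero, one_mul, zero_add, Nat.factorial_zero, Nat.cast_one]
    rw [h, sub_self, sub_zero, integral_pow, Nat.factorial_succ]
    have := Nat.cast_ne_zero (R := ℝ).2 (Nat.factorial_ne_zero k)
    push_cast
    field_simp
    ring
  | succ m ih =>
    intro k t
    have hd : ∀ y ∈ uIcc 0 t, HasDerivAt (fun y : ℝ => y ^ (m + 1) * (t - y) ^ (k + 1))
        ((m + 1) * (y ^ m * (t - y) ^ (k + 1)) - (k + 1) * (y ^ (m + 1) * (t - y) ^ k)) y := by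
      intro y _
      have h1 : HasDerivAt (fun y : ℝ => (t - y) ^ (k + 1)) (((k : ℝ) + 1) * (t - y) ^ k * -1) y := by
        convert! ((hasDerivAt_id y).const_sub t).fun_pow (k + 1) using 1
        simp
      have h2 := (hasDerivAt_pow (m + 1) y).mul h1
      convert! h2 using 1
      push_cast
      ring
    have hi : ∀ i j : ℕ, IntervalIntegrable (fun y : ℝ => y ^ i * (t - y) ^ j) volume 0 t :=
      fun i j => Continuous.intervalIntegrable (by fun_prop) _ _
    have h3 := intervalIntegral.integral_eq_sub_of_hasDerivAt hd
      (((hi m (k + 1)).const_mul _).sub ((hi (m + 1) k).const_mul _))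
    rw [intervalIntegral.integral_sub ((hi m (k + 1)).const_mul _) ((hi (m + 1) k).const_mul _),
      intervalIntegral.integral_const_mul, intervalIntegral.integral_const_mul, ih (k + 1) t] at h3
    have hk : ((k : ℝ) + 1) ≠ 0 := by positivity
    refine mul_left_cancel₀ hk ?_
    have h4 : m + (k + 1) + 1 = m + 1 + k + 1 := by ring
    rw [h4, Nat.factorial_succ k] at h3
    rw [Nat.factorial_succ m]
    simp only [sub_self, ne_eq, Nat.add_eq_zero_iff, one_ne_zero, and_false, not_false_eq_true,
      zero_pow, mul_zero, zero_mul, sub_zero] at h3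
    push_cast at h3 ⊢
    linear_combination -h3

/-- Termwise Beta integrals of the exponential series; up to a factor, this sums the row of the
ballot series with `m + 1` claims. -/
theorem hasSum_integral_pow_mul_exp (m : ℕ) (c : ℝ) {t : ℝ} (ht : 0 ≤ t) :
    HasSum (fun n : ℕ => c ^ n * (n + 1) * m ! / (n + m + 2)! * t ^ (n + m + 2))
      (∫ y in (0 : ℝ)..t, y ^ m * (t - y) * Real.exp (c * (t - y))) := by
  have h := intervalIntegral.hasSum_integral_of_dominated_convergence (μ := volume)
    (a := 0) (b := t) (F := fun (n : ℕ) (y : ℝ) => c ^ n / n ! * (y ^ m * (t - y) ^ (n + 1)))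
    (f := fun y => y ^ m * (t - y) * Real.exp (c * (t - y)))
    (fun n _ => t ^ m * t * ((|c| * t) ^ n / n !)) ?_ ?_ ?_ ?_ ?_
  · convert! h using 2 with n
    rw [intervalIntegral.integral_const_mul, integral_pow_mul_sub_pow, Nat.factorial_succ n,
      show m + (n + 1) + 1 = n + m + 2 by ring]
    have := Nat.cast_ne_zero (R := ℝ).2 (Nat.factorial_ne_zero n)
    push_cast
    field_simp
  · exact fun n => (Continuous.aestronglyMeasurable (by fun_prop))
  · refine fun n => ae_of_all _ fun y hy => ?_
    rw [uIoc_of_le ht] at hy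
    have h1 : 0 ≤ t - y := by linarith [hy.2]
    have h2 : t - y ≤ t := by linarith [hy.1]
    rw [norm_mul, norm_div, norm_pow, norm_mul, norm_pow, norm_pow, Real.norm_of_nonneg h1,
      Real.norm_of_nonneg hy.1.le, Real.norm_eq_abs, Real.norm_of_nonneg (Nat.cast_nonneg _),
      mul_pow]
    have h3 : y ^ m ≤ t ^ m := pow_le_pow_left₀ hy.1.le hy.2 m
    have h4 : (t - y) ^ (n + 1) ≤ t ^ (n + 1) := pow_le_pow_left₀ h1 h2 _
    calc |c| ^ n / n ! * (y ^ m * (t - y) ^ (n + 1))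
        ≤ |c| ^ n / n ! * (t ^ m * t ^ (n + 1)) := by gcongr
      _ = _ := by ring
  · exact ae_of_all _ fun y _ => (Real.summable_pow_div_factorial _).mul_left _
  · simp
  · refine ae_of_all _ fun y _ => ?_
    have h1 := NormedSpace.expSeries_div_hasSum_exp (c * (t - y))
    rw [← Real.exp_eq_exp_ℝ] at h1
    convert! h1.mul_left (y ^ m * (t - y)) using 2 with n
    rw [mul_pow]
    ring

/-- The coefficients of the double exponential series. -/
def expCoeff (x y : ℝ) (i j : ℕ) : ℝ := x ^ i / i ! * (y ^ j / j !)

theorem expCoeff_comm (x y : ℝ) (i j : ℕ) : expCoeff x y i j = expCoeff y x j i := mul_comm _ _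

theorem hasSum_expCoeff {x y : ℝ} (hx : 0 ≤ x) (hy : 0 ≤ y) :
    HasSum (fun z : ℕ × ℕ => expCoeff x y z.1 z.2) (Real.exp x * Real.exp y) := by
  have h : ∀ x : ℝ, HasSum (fun n : ℕ => x ^ n / n !) (Real.exp x) := fun x => by
    rw [Real.exp_eq_exp_ℝ]
    exact NormedSpace.expSeries_div_hasSum_exp x
  exact (h x).mul (h y) ((h x).summable.mul_of_nonneg (h y).summable
    (fun n => by positivity) (fun n => by positivity))

theorem hasSum_expCoeff_comp {x y : ℝ} (hx : 0 ≤ x) (hy : 0 ≤ y) {ι : Type*} {i j : ι → ℕ}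
    (hinj : Function.Injective fun z => (i z, j z)) :
    HasSum (fun z => expCoeff x y (i z) (j z)) (∑' z, expCoeff x y (i z) (j z)) :=
  ((hasSum_expCoeff hx hy).summable.comp_injective hinj).hasSum

/-- The pairs `(k, n)` parametrise the half-plane of indices `(i, j)` with `i ≥ j + s`. -/
theorem injective_add_left (s : ℕ) :
    Function.Injective fun z : ℕ × ℕ => (z.2 + z.1 + s, z.1) := by
  rintro ⟨i, j⟩ ⟨i', j'⟩ h
  simp only [Prod.mk.injEq] at h ⊢
  omega

theorem injective_add_right (s : ℕ) :
    Function.Injective fun z : ℕ × ℕ => (z.1, z.2 + z.1 + s) := by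
  rintro ⟨i, j⟩ ⟨i', j'⟩ h
  simp only [Prod.mk.injEq] at h ⊢
  omega

/-- The double exponential series split into a closed half-plane, the adjacent diagonal and an
open half-plane. -/
theorem exp_mul_exp_eq {x y : ℝ} (hx : 0 ≤ x) (hy : 0 ≤ y) :
    Real.exp x * Real.exp y
      = ∑' z : ℕ × ℕ, expCoeff x y (z.2 + z.1) z.1 + ∑' k : ℕ, expCoeff x y k (k + 1)
        + ∑' z : ℕ × ℕ, expCoeff x y z.1 (z.2 + z.1 + 2) := by
  have hdiag : Function.Injective fun k : ℕ => (k, k + 1) := fun i j h => (Prod.mk.inj h).1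
  have h1 := hasSum_expCoeff_comp hx hy (injective_add_left 0)
  have h2 := hasSum_expCoeff_comp hx hy hdiag
  have h3 := hasSum_expCoeff_comp hx hy (injective_add_right 2)
  -- Each of the three sums is extended by zero to all of `ℕ × ℕ`, so that they can be added
  -- pointwise.
  have k1 := (Function.Injective.hasSum_iff (f := fun z : ℕ × ℕ =>
    if z.2 ≤ z.1 then expCoeff x y z.1 z.2 else 0) (injective_add_left 0) (by
      rintro ⟨i, j⟩ hz
      refine if_neg fun hle => hz ⟨(j, i - j), ?_⟩
      simp only [Prod.mk.injEq, and_true] at hle ⊢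
      omega)).1 (h1.congr_fun fun z => if_pos (by simp))
  have k2 := (Function.Injective.hasSum_iff (f := fun z : ℕ × ℕ =>
    if z.2 = z.1 + 1 then expCoeff x y z.1 z.2 else 0) hdiag (by
      rintro ⟨i, j⟩ hz
      refine if_neg fun hle => hz ⟨i, ?_⟩
      simp only [Prod.mk.injEq, true_and] at hle ⊢
      omega)).1 (h2.congr_fun fun z => if_pos rfl)
  have k3 := (Function.Injective.hasSum_iff (f := fun z : ℕ × ℕ =>
    if z.1 + 2 ≤ z.2 then expCoeff x y z.1 z.2 else 0) (injective_add_right 2) (by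
      rintro ⟨i, j⟩ hz
      refine if_neg fun hle => hz ⟨(i, j - i - 2), ?_⟩
      simp only [Prod.mk.injEq, true_and] at hle ⊢
      omega)).1 (h3.congr_fun fun z => if_pos (by simp only; omega))
  refine (hasSum_expCoeff hx hy).unique (((k1.add k2).add k3).congr_fun fun z => ?_)
  rcases lt_trichotomy z.2 (z.1 + 1) with h | h | h
  · rw [if_pos (by omega), if_neg (by omega), if_neg (by omega)]
    ring
  · rw [if_neg (by omega), if_pos (by omega), if_neg (by omega)]
    ring
  · rw [if_neg (by omega), if_neg (by omega), if_pos (by omega)]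
    ring

/-- The terms of the ballot series; the index `(k, n)` has `k` claims. -/
def ballotTerm (c d t : ℝ) (z : ℕ × ℕ) : ℝ :=
  c ^ (z.2 + z.1 + 1) * d ^ z.1 * t ^ (z.2 + 2 * z.1) * (z.2 + 1) / (z.1 ! * (z.2 + z.1 + 1)!)

/-- The ballot factor splits as `(n+1) / (k! (n+k+1)!) = 1 / (k! (n+k)!) - 1 / ((k-1)! (n+k+1)!)`,
the last fraction being absent for `k = 0`. The second part is therefore reindexed by `k = j + 1`.
-/
theorem hasSum_ballotTerm {c d t : ℝ} (hc : 0 ≤ c) (hd : 0 ≤ d) (ht : 0 ≤ t) :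
    HasSum (ballotTerm c d t)
      (c * ∑' z : ℕ × ℕ, expCoeff (c * t) (d * t) (z.2 + z.1) z.1
        - d * ∑' z : ℕ × ℕ, expCoeff (c * t) (d * t) (z.2 + z.1 + 2) z.1) := by
  have hx : 0 ≤ c * t := mul_nonneg hc ht
  have hy : 0 ≤ d * t := mul_nonneg hd ht
  have h1 := hasSum_expCoeff_comp hx hy (injective_add_left 0)
  have h2 := hasSum_expCoeff_comp hx hy (injective_add_left 2)
  have hinj : Function.Injective fun z : ℕ × ℕ => (z.1 + 1, z.2) := by
    rintro ⟨i, j⟩ ⟨i', j'⟩ h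
    simp only [Prod.mk.injEq] at h ⊢
    omega
  have k2 := (Function.Injective.hasSum_iff (f := fun z : ℕ × ℕ =>
    if z.1 = 0 then 0 else expCoeff (c * t) (d * t) (z.2 + (z.1 - 1) + 2) (z.1 - 1)) hinj (by
      rintro ⟨i, j⟩ hz
      refine if_pos ?_
      by_contra hi
      refine hz ⟨(i - 1, j), ?_⟩
      simp only [Prod.mk.injEq, and_true] at hi ⊢
      omega)).1 (h2.congr_fun fun z => by simp)
  refine ((h1.mul_left c).sub (k2.mul_left d)).congr_fun ?_
  rintro ⟨k, n⟩
  rcases k with - | j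
  · simp only [ballotTerm, expCoeff, if_pos, add_zero, Nat.factorial_succ]
    push_cast
    have := Nat.cast_ne_zero (R := ℝ).2 (Nat.factorial_ne_zero n)
    field_simp
    simp
    ring
  · rw [if_neg (by simp)]
    simp only [ballotTerm, expCoeff, Nat.add_sub_cancel, add_zero]
    rw [show n + (j + 1) + 1 = n + j + 1 + 1 by ring, show n + j + 2 = n + j + 1 + 1 by ring,
      show n + (j + 1) = n + j + 1 by ring, Nat.factorial_succ (n + j + 1), Nat.factorial_succ j,
      show n + 2 * (j + 1) = (n + j + 1) + (j + 1) by ring]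
    have h3 := Nat.cast_ne_zero (R := ℝ).2 (Nat.factorial_ne_zero (n + j + 1))
    have h4 := Nat.cast_ne_zero (R := ℝ).2 (Nat.factorial_ne_zero j)
    push_cast
    have h5 : (n : ℝ) + j + 1 + 1 ≠ 0 := by positivity
    have h6 : (j : ℝ) + 1 ≠ 0 := by positivity
    field_simp
    ring

/-- The parts with coefficient `a` cover all indices except the diagonal `(k, k+1)`, and those with
coefficient `b` all except its mirror image. The missing diagonals have equal weighted sums, since
`a (a t)^k (b t)^(k+1) = b (b t)^k (a t)^(k+1)`. -/
theorem hasSum_ballotTerm_sub {a b t : ℝ} (ha : 0 ≤ a) (hb : 0 ≤ b) (ht : 0 ≤ t) :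
    HasSum (fun z => ballotTerm a b t z - ballotTerm b a t z)
      ((a - b) * Real.exp ((a + b) * t)) := by
  have hx : 0 ≤ a * t := mul_nonneg ha ht
  have hy : 0 ≤ b * t := mul_nonneg hb ht
  have h := (hasSum_ballotTerm ha hb ht).sub (hasSum_ballotTerm hb ha ht)
  convert! h using 1
  have e1 := exp_mul_exp_eq hx hy
  have e2 := exp_mul_exp_eq hy hx
  simp only [expCoeff_comm (a * t) (b * t) _ (_ + 2)] at e1
  simp only [expCoeff_comm (b * t) (a * t) _ (_ + 2)] at e2
  have e3 : a * ∑' k : ℕ, expCoeff (a * t) (b * t) k (k + 1)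
      = b * ∑' k : ℕ, expCoeff (b * t) (a * t) k (k + 1) := by
    rw [← tsum_mul_left, ← tsum_mul_left]
    refine tsum_congr fun k => ?_
    simp only [expCoeff, mul_pow]
    ring
  rw [add_mul, Real.exp_add]
  linear_combination a * e1 - b * e2 + e3

section Model

variable {Ω : Type*} [MeasurableSpace Ω] {P : Measure Ω} [IsProbabilityMeasure P]
  {lam mu : ℝ} {N : ℝ≥0 → Ω → ℕ} {U : ℕ → Ω → ℝ} {p : ℝ} {r : ℝ≥0}

/-- Kendall's identity, integrated against the scale function. -/
theorem integral_cutoff_expScale (hNU : IsClaimModel P lam mu N U) (hr : 0 < r) {q u v : ℝ}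
    (h : IsRootPair p lam mu q u v) :
    ∫ z in Ioi 0, cutoff p r (p * r) (expScale p mu u v) z ∂(P.map (cramerLundberg p N U r))
      = Real.exp (q * r) := by
  have hr' : (0 : ℝ) < r := hr
  have hp := h.p_pos
  have ht : 0 ≤ p * r := by positivity
  have ha := h.add_mu_pos
  have hb := h.add_mu_pos'
  have hs := h.sub_pos
  have hab := h.mul_add_mu
  set t := p * (r : ℝ) with ht_def
  set a := u + mu with ha_def
  set b := v + mu with hb_def
  have hsub : a - b = u - v := by
    rw [ha_def, hb_def]
    ring
  set E := Real.exp (-(lam * r)) * Real.exp (-(mu * t)) with hE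
  have h1 := hasSum_integral_cutoff hNU h.lam_pos.le h.mu_pos hp hr ht le_rfl
    (IsRootPair.continuous_expScale (p := p) (mu := mu) (u := u) (v := v))
  have h2 := (hasSum_ballotTerm_sub ha.le hb.le ht).mul_left (E / (a - b))
  have hg : ∀ x, expScale p mu u v x
      = 1 / (p * (a - b)) * Real.exp (-(mu * x)) * (a * Real.exp (a * x) - b * Real.exp (b * x)) := by
    intro x
    have e1 : Real.exp (a * x) = Real.exp (u * x) * Real.exp (mu * x) := by
      rw [← Real.exp_add, ha_def, add_mul]
    have e2 : Real.exp (b * x) = Real.exp (v * x) * Real.exp (mu * x) := by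
      rw [← Real.exp_add, hb_def, add_mul]
    have e3 : Real.exp (-(mu * x)) * Real.exp (mu * x) = 1 := by
      rw [← Real.exp_add, neg_add_cancel, Real.exp_zero]
    have e4 : 1 / (p * (a - b)) = 1 / p / (u - v) := by
      rw [hsub, div_div]
    rw [e1, e2, e4, expScale]
    rw [ha_def, hb_def]
    linear_combination (-(1 / p / (u - v) *
      ((u + mu) * Real.exp (u * x) - (v + mu) * Real.exp (v * x)))) * e3
  -- Row `0` is the contribution of the atom at `p r`; row `m + 1` is that of `m + 1` claims.
  have hzero : HasSum (fun n : ℕ => E / (a - b) * (ballotTerm a b t (0, n) - ballotTerm b a t (0, n)))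
      (Real.exp (-(lam * r)) * (p * expScale p mu u v t)) := by
    have k1 : ∀ c d : ℝ, HasSum (fun n : ℕ => ballotTerm c d t (0, n)) (c * Real.exp (c * t)) := by
      intro c d
      have k2 := NormedSpace.expSeries_div_hasSum_exp (c * t)
      rw [← Real.exp_eq_exp_ℝ] at k2
      refine (k2.mul_left c).congr_fun fun n => ?_
      simp only [ballotTerm, add_zero, Nat.factorial_succ, mul_zero, pow_zero, mul_one,
        Nat.factorial_zero, Nat.cast_one, one_mul, mul_pow]
      have := Nat.cast_ne_zero (R := ℝ).2 (Nat.factorial_ne_zero n)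
      push_cast
      field_simp
      ring
    convert! ((k1 a b).sub (k1 b a)).mul_left (E / (a - b)) using 1
    rw [hg t, hE]
    field_simp
  have hsucc : ∀ m : ℕ, HasSum
      (fun n : ℕ => E / (a - b) * (ballotTerm a b t (m + 1, n) - ballotTerm b a t (m + 1, n)))
      (Real.exp (-(lam * r)) * ((lam * r * mu) ^ (m + 1) / (m ! * (m + 1)!) *
        ∫ y in (0 : ℝ)..t, y ^ m * Real.exp (-(mu * y)) *
          (expScale p mu u v (t - y) * ((t - y) / r)))) := by
    intro m
    have k1 : ∀ c d : ℝ, a * b = c * d → HasSum (fun n : ℕ => ballotTerm c d t (m + 1, n))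
        ((a * b) ^ (m + 1) * t ^ m / (m ! * (m + 1)!) *
          (c * ∫ y in (0 : ℝ)..t, y ^ m * (t - y) * Real.exp (c * (t - y)))) := by
      intro c d hcd
      refine (((hasSum_integral_pow_mul_exp m c ht).mul_left c).mul_left _).congr_fun fun n => ?_
      have := Nat.cast_ne_zero (R := ℝ).2 (Nat.factorial_ne_zero m)
      simp only [ballotTerm]
      rw [hcd, show n + (m + 1) + 1 = n + m + 2 by ring, mul_pow]
      field_simp
      ring
    have hi : ∀ c : ℝ, IntervalIntegrable
        (fun y : ℝ => y ^ m * (t - y) * Real.exp (c * (t - y))) volume 0 t :=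
      fun c => Continuous.intervalIntegrable (by fun_prop) _ _
    have k2 : ∫ y in (0 : ℝ)..t, y ^ m * Real.exp (-(mu * y)) *
          (expScale p mu u v (t - y) * ((t - y) / r))
        = Real.exp (-(mu * t)) / (t * (a - b)) *
          (a * (∫ y in (0 : ℝ)..t, y ^ m * (t - y) * Real.exp (a * (t - y)))
            - b * ∫ y in (0 : ℝ)..t, y ^ m * (t - y) * Real.exp (b * (t - y))) := by
      rw [← intervalIntegral.integral_const_mul, ← intervalIntegral.integral_const_mul,
        ← intervalIntegral.integral_sub ((hi a).const_mul _) ((hi b).const_mul _),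
        ← intervalIntegral.integral_const_mul]
      refine intervalIntegral.integral_congr fun y _ => ?_
      have e1 : Real.exp (-(mu * t)) = Real.exp (-(mu * y)) * Real.exp (-(mu * (t - y))) := by
        rw [← Real.exp_add]
        ring_nf
      simp only [hg (t - y)]
      rw [e1, ht_def]
      field_simp
    have htpos : 0 < t := mul_pos hp hr'
    convert! ((k1 a b rfl).sub (k1 b a (mul_comm a b))).mul_left (E / (a - b)) using 1
    rw [k2, hE, show lam * r * mu = a * b * t by
      rw [ht_def]
      linear_combination (-(r : ℝ)) * hab, mul_pow (a * b) t, pow_succ t m]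
    field_simp
  have h3 := h2.prod_fiberwise (g := fun k => Nat.casesOn k
    (Real.exp (-(lam * r)) * (p * expScale p mu u v t)) fun m =>
      Real.exp (-(lam * r)) * ((lam * r * mu) ^ (m + 1) / (m ! * (m + 1)!) *
        ∫ y in (0 : ℝ)..t, y ^ m * Real.exp (-(mu * y)) *
          (expScale p mu u v (t - y) * ((t - y) / r)))) (by
      rintro (- | m)
      · exact hzero
      · exact hsucc m)
  rw [← hasSum_nat_add_iff' 1] at h3
  have h4 := h1.unique h3
  rw [Finset.sum_range_one] at h4
  -- The exponents add up to `q r` because `p (a + b) = q + lam + mu p`.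
  have h5 : Real.exp (q * r) = E / (a - b) * ((a - b) * Real.exp ((a + b) * t)) := by
    have hne : a - b ≠ 0 := by
      rw [hsub]
      exact hs.ne'
    rw [← mul_assoc, div_mul_cancel₀ _ hne, hE, ← Real.exp_add, ← Real.exp_add, ha_def, hb_def,
      ht_def]
    congr 1
    linear_combination (-(r : ℝ)) * h.sum
  rw [h5]
  exact sub_left_inj.1 h4

end Model

/-! ### Refraction: separation of the variables `x` and `z`. -/

/-- The derivative of `expScale`. -/
def expScaleDeriv (p mu u v x : ℝ) : ℝ :=
  1 / p * ((mu + u) / (u - v) * (Real.exp (u * x) * u)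
    - (mu + v) / (u - v) * (Real.exp (v * x) * v))

/-- The convolution of `expScale` with `exp (-mu x)`. -/
def expScaleConv (p u v x : ℝ) : ℝ :=
  1 / (p * (u - v)) * (Real.exp (u * x) - Real.exp (v * x))

theorem continuous_expScaleDeriv (p mu u v : ℝ) : Continuous (expScaleDeriv p mu u v) := by
  unfold expScaleDeriv
  fun_prop

theorem hasDerivAt_exp_const_mul (c x : ℝ) :
    HasDerivAt (fun x => Real.exp (c * x)) (Real.exp (c * x) * c) x := by
  simpa using ((hasDerivAt_id x).const_mul c).exp

theorem deriv_ite_expScale {p mu u v x : ℝ} (hx : 0 < x) :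
    deriv (fun x => if x < 0 then 0 else expScale p mu u v x) x = expScaleDeriv p mu u v x := by
  have h : (fun x => if x < 0 then 0 else expScale p mu u v x) =ᶠ[𝓝 x] expScale p mu u v := by
    filter_upwards [lt_mem_nhds hx] with y hy
    exact if_neg (not_lt.2 hy.le)
  rw [h.deriv_eq]
  exact (IsRootPair.hasDerivAt_expScale x).deriv

namespace IsRootPair

variable {p lam mu q u v : ℝ} (h : IsRootPair p lam mu q u v)
include h

/-- Both roots satisfy `(mu + θ) (q + lam - p θ) = lam mu`. The identity trades the convolution for
`W` and `W'`. -/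
theorem mul_expScaleConv (x : ℝ) : lam * mu * expScaleConv p u v x
    = (q + lam) * expScale p mu u v x - p * expScaleDeriv p mu u v x := by
  have hp := h.p_pos
  have hs := h.sub_pos
  have h1 : (mu + u) * (q + lam - p * u) = lam * mu := by
    linear_combination h.prod - u * h.sum
  have h2 : (mu + v) * (q + lam - p * v) = lam * mu := by
    linear_combination h.prod - v * h.sum
  have e : (q + lam) * expScale p mu u v x - p * expScaleDeriv p mu u v x
      = 1 / (p * (u - v)) * ((mu + u) * (q + lam - p * u) * Real.exp (u * x)
        - (mu + v) * (q + lam - p * v) * Real.exp (v * x)) := by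
    rw [expScale, expScaleDeriv]
    field_simp
    ring
  rw [e, h1, h2, expScaleConv]
  ring

theorem hasDerivAt_expScaleConv (x : ℝ) : HasDerivAt (expScaleConv p u v)
    (expScale p mu u v x - mu * expScaleConv p u v x) x := by
  have hp := h.p_pos
  have hs := h.sub_pos
  convert! ((hasDerivAt_exp_const_mul u x).sub (hasDerivAt_exp_const_mul v x)).const_mul
    (1 / (p * (u - v))) using 1
  rw [expScale, expScaleConv]
  field_simp
  ring

/-- The refraction of an exponential at a root of `p θ - lam + lam mu / (θ + mu) = q`. -/
theorem exp_add_integral {delta θ : ℝ} (hθ : 0 < θ + mu)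
    (hroot : (p + delta) * θ - lam + lam * mu / (θ + mu) = q) (x : ℝ) :
    Real.exp (θ * x) + delta * ∫ y in (0 : ℝ)..x,
        expScale p mu u v (x - y) * (Real.exp (θ * y) * θ)
      = p * expScale p mu u v x - lam * mu / (θ + mu) * expScaleConv p u v x := by
  set k := lam * mu / (θ + mu) with hk
  have hkmul : k * (θ + mu) = lam * mu := div_mul_cancel₀ _ hθ.ne'
  -- An explicit antiderivative: its derivative reduces to the integrand through `K' = W - mu K`,
  -- `mul_expScaleConv` and the root equation for `p + delta`. At `y = x` it equals `-exp (θ x)`,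
  -- which cancels the free exponential.
  have hd : ∀ y ∈ uIcc 0 x, HasDerivAt
      (fun y => -(Real.exp (θ * y) *
        (p * expScale p mu u v (x - y) - k * expScaleConv p u v (x - y))))
      (delta * (expScale p mu u v (x - y) * (Real.exp (θ * y) * θ))) y := by
    intro y _
    have h1 := (IsRootPair.hasDerivAt_expScale (p := p) (mu := mu) (u := u) (v := v)
      (x - y)).comp_const_sub x y
    have h2 := (h.hasDerivAt_expScaleConv (x - y)).comp_const_sub x y
    have h3 := h.mul_expScaleConv (x - y)
    rw [← expScaleDeriv] at h1
    convert! ((hasDerivAt_exp_const_mul θ y).mul ((h1.const_mul p).sub (h2.const_mul k))).neg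
      using 1
    simp only [Pi.sub_apply]
    clear_value k
    linear_combination Real.exp (θ * y) * expScale p mu u v (x - y) * hroot
      - Real.exp (θ * y) * h3 - Real.exp (θ * y) * expScaleConv p u v (x - y) * hkmul
  have hc : Continuous (expScale p mu u v) := continuous_expScale
  have h4 := intervalIntegral.integral_eq_sub_of_hasDerivAt hd
    (Continuous.intervalIntegrable (by fun_prop) _ _)
  rw [intervalIntegral.integral_const_mul] at h4
  rw [h4, sub_self, h.expScale_zero, sub_zero, mul_zero, Real.exp_zero, expScaleConv]
  have hp := h.p_pos
  simp only [mul_zero, sub_self, Real.exp_zero]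
  field_simp
  ring

end IsRootPair

theorem refractedScale_of_nonpos {p r delta mu u v x z : ℝ} (WY : ℝ → ℝ) (hx : x ≤ 0) :
    refractedScale (fun x => if x < 0 then 0 else expScale p mu u v x) WY delta x (-z) * (z / r)
      = cutoff p r (p * r + x) (expScale p mu u v) z := by
  have h1 : z - p * r + (p * r + x) = x - -z := by ring
  rw [cutoff, h1]
  -- At `x = 0` the other branch of the definition applies, but its integral is over an empty
  -- interval.
  rcases hx.eq_or_lt with rfl | hx
  · rw [refractedScale, if_neg (lt_irrefl 0), intervalIntegral.integral_same, mul_zero, add_zero]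
  · rw [refractedScale, if_pos hx]

/-- `W` jumps at `0`; as `z > 0`, the derivative is only taken at points `y + z > 0`, where `W` is
smooth. -/
theorem eqOn_refraction_integrand {p p' mu u v u' v' x z : ℝ} (hx : 0 ≤ x) (hz : 0 < z) :
    EqOn (fun y => (if x - y < 0 then 0 else expScale p' mu u' v' (x - y)) *
        deriv (fun x => if x < 0 then 0 else expScale p mu u v x) (y + z))
      (fun y => expScale p' mu u' v' (x - y) * expScaleDeriv p mu u v (y + z)) (uIcc 0 x) := by
  intro y hy
  rw [uIcc_of_le hx] at hy
  simp only
  rw [if_neg (by linarith [hy.2]), deriv_ite_expScale (by linarith [hy.1])]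

/-- `W(z + ·)` is a combination of exponentials at the roots `u`, `v` for premium `p = (p - delta) +
delta`, so `exp_add_integral` applies to each. The coefficients then recombine into `W(z)` and `lam
mu K(z)`. -/
theorem refractedScale_of_nonneg {p lam mu q delta u v u' v' x z : ℝ}
    (h : IsRootPair p lam mu q u v) (h' : IsRootPair (p - delta) lam mu q u' v')
    (hx : 0 ≤ x) (hz : 0 < z) :
    refractedScale (fun x => if x < 0 then 0 else expScale p mu u v x)
        (fun x => if x < 0 then 0 else expScale (p - delta) mu u' v' x) delta x (-z)
      = (p - delta) * expScale (p - delta) mu u' v' x * expScale p mu u v z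
        - lam * mu * expScaleConv (p - delta) u' v' x * expScaleConv p u v z := by
  have hp := h.p_pos
  have hs := h.sub_pos
  have hu := h.add_mu_pos
  have hv := h.add_mu_pos'
  rw [refractedScale, if_neg (not_lt.2 hx), sub_neg_eq_add, if_neg (by linarith)]
  simp only [sub_neg_eq_add]
  rw [intervalIntegral.integral_congr (eqOn_refraction_integrand hx hz)]
  have hc : Continuous (expScale (p - delta) mu u' v') := IsRootPair.continuous_expScale
  have hi : ∀ θ : ℝ, IntervalIntegrable (fun y => expScale (p - delta) mu u' v' (x - y) *
      (Real.exp (θ * y) * θ)) volume 0 x :=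
    fun θ => Continuous.intervalIntegrable (by fun_prop) _ _
  have hsplit : ∫ y in (0 : ℝ)..x, expScale (p - delta) mu u' v' (x - y) *
        expScaleDeriv p mu u v (y + z)
      = 1 / p * ((mu + u) / (u - v)) * Real.exp (u * z) *
          (∫ y in (0 : ℝ)..x, expScale (p - delta) mu u' v' (x - y) * (Real.exp (u * y) * u))
        - 1 / p * ((mu + v) / (u - v)) * Real.exp (v * z) *
          ∫ y in (0 : ℝ)..x, expScale (p - delta) mu u' v' (x - y) * (Real.exp (v * y) * v) := by
    rw [← intervalIntegral.integral_const_mul, ← intervalIntegral.integral_const_mul,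
      ← intervalIntegral.integral_sub ((hi u).const_mul _) ((hi v).const_mul _)]
    refine intervalIntegral.integral_congr fun y _ => ?_
    simp only [expScaleDeriv, mul_add, Real.exp_add]
    ring
  have e1 := h'.exp_add_integral (delta := delta) hu (by rw [sub_add_cancel]; exact h.exponent_left) x
  have e2 := h'.exp_add_integral (delta := delta) hv (by rw [sub_add_cancel]; exact h.exponent_right) x
  have e3 : expScale p mu u v (x + z)
      = 1 / p * ((mu + u) / (u - v)) * Real.exp (u * z) * Real.exp (u * x)
        - 1 / p * ((mu + v) / (u - v)) * Real.exp (v * z) * Real.exp (v * x) := by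
    simp only [expScale, mul_add, Real.exp_add]
    ring
  have e4 : 1 / p * ((mu + u) / (u - v)) * Real.exp (u * z) * (lam * mu / (u + mu))
      - 1 / p * ((mu + v) / (u - v)) * Real.exp (v * z) * (lam * mu / (v + mu))
      = lam * mu * expScaleConv p u v z := by
    rw [expScaleConv, add_comm mu u, add_comm mu v]
    field_simp
  have e5 : 1 / p * ((mu + u) / (u - v)) * Real.exp (u * z)
      - 1 / p * ((mu + v) / (u - v)) * Real.exp (v * z) = expScale p mu u v z := by
    rw [expScale]
    ring
  rw [hsplit, e3]
  linear_combination (1 / p * ((mu + u) / (u - v)) * Real.exp (u * z)) * e1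
    - (1 / p * ((mu + v) / (u - v)) * Real.exp (v * z)) * e2
    + (p - delta) * expScale (p - delta) mu u' v' x * e5
    - expScaleConv (p - delta) u' v' x * e4

theorem refractedScale_mul_eq_cutoff {p lam mu q delta u v u' v' x z r : ℝ}
    (h : IsRootPair p lam mu q u v) (h' : IsRootPair (p - delta) lam mu q u' v')
    (hx : 0 ≤ x) (hz : 0 < z) :
    refractedScale (fun x => if x < 0 then 0 else expScale p mu u v x)
        (fun x => if x < 0 then 0 else expScale (p - delta) mu u' v' x) delta x (-z) * (z / r)
      = cutoff p r (p * r) (fun z =>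
        ((p - delta) * expScale (p - delta) mu u' v' x
          - (q + lam) * expScaleConv (p - delta) u' v' x) * expScale p mu u v z
        + p * expScaleConv (p - delta) u' v' x * expScaleDeriv p mu u v z) z := by
  rw [refractedScale_of_nonneg h h' hx hz, cutoff, sub_add_cancel, if_neg (not_lt.2 hz.le)]
  linear_combination (-(expScaleConv (p - delta) u' v' x * (z / r))) * h.mul_expScaleConv z

/-! ### Closed forms of the integrals of `W` and `W'`. -/

section Model

variable {Ω : Type*} [MeasurableSpace Ω] {P : Measure Ω} [IsProbabilityMeasure P]
  {lam mu : ℝ} {N : ℝ≥0 → Ω → ℕ} {U : ℕ → Ω → ℝ} {p : ℝ} {r : ℝ≥0}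

theorem integral_cutoff_linear (hNU : IsClaimModel P lam mu N U) (L α β : ℝ) {f g : ℝ → ℝ}
    (hf : Continuous f) (hg : Continuous g) :
    ∫ z in Ioi 0, cutoff p r L (fun x => α * f x + β * g x) z ∂(P.map (cramerLundberg p N U r))
      = α * ∫ z in Ioi 0, cutoff p r L f z ∂(P.map (cramerLundberg p N U r))
        + β * ∫ z in Ioi 0, cutoff p r L g z ∂(P.map (cramerLundberg p N U r)) := by
  rw [← integral_const_mul, ← integral_const_mul,
    ← integral_add ((integrableOn_cutoff hNU p L r hf).const_mul α)
      ((integrableOn_cutoff hNU p L r hg).const_mul β)]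
  refine integral_congr_ae (ae_of_all _ fun z => ?_)
  simp only [cutoff]
  split_ifs <;> ring

/-- The Bessel-type boundary series of the two exponentials have opposite coefficients `± 1 / (p r
(u - v))` and cancel. -/
theorem integral_cutoff_expScale_eq (hNU : IsClaimModel P lam mu N U) (hr : 0 < r)
    {q u v L : ℝ} (h : IsRootPair p lam mu q u v) (hL : 0 ≤ L) (hLp : L ≤ p * r) :
    ∫ z in Ioi 0, cutoff p r L (expScale p mu u v) z ∂(P.map (cramerLundberg p N U r))
      = Real.exp (-(lam * r)) * (p * expScale p mu u v L
        + (mu + v) / (u - v) * Real.exp (u * L) * ∑' m, gammaTerm p r (u + mu) (v + mu) L m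
        - (mu + u) / (u - v) * Real.exp (v * L) * ∑' m, gammaTerm p r (v + mu) (u + mu) L m) := by
  have hr' : (0 : ℝ) < r := hr
  have hp := h.p_pos
  have hs := h.sub_pos
  have hu := h.add_mu_pos
  have hv := h.add_mu_pos'
  have hfun : expScale p mu u v = fun x => 1 / p * ((mu + u) / (u - v)) * Real.exp (u * x)
      + -(1 / p * ((mu + v) / (u - v))) * Real.exp (v * x) := by
    funext x
    rw [expScale]
    ring
  rw [hfun, integral_cutoff_linear hNU _ _ _ (by fun_prop) (by fun_prop),
    integral_cutoff_exp hNU h.lam_pos h.mu_pos hp hr hL hLp hu h.mul_add_mu,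
    integral_cutoff_exp hNU h.lam_pos h.mu_pos hp hr hL hLp hv
      (by rw [mul_comm (v + mu)]; exact h.mul_add_mu), add_comm mu u, add_comm mu v]
  field_simp
  ring

/-- Differentiation weights the boundary series by `u` and `v`, so they no longer cancel: `(u - v) /
(u - v) = 1` leaves the extra series of `C`. -/
theorem integral_cutoff_expScaleDeriv_eq (hNU : IsClaimModel P lam mu N U) (hr : 0 < r)
    {q u v L : ℝ} (h : IsRootPair p lam mu q u v) (hL : 0 ≤ L) (hLp : L ≤ p * r) :
    ∫ z in Ioi 0, cutoff p r L (expScaleDeriv p mu u v) z ∂(P.map (cramerLundberg p N U r))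
      = Real.exp (-(lam * r)) * (p * expScaleDeriv p mu u v L
        + (mu + v) / (u - v) * u * Real.exp (u * L) * ∑' m, gammaTerm p r (u + mu) (v + mu) L m
        - (mu + u) / (u - v) * v * Real.exp (v * L) * ∑' m, gammaTerm p r (v + mu) (u + mu) L m
        + Real.exp (-(mu * L)) / (p * r) *
          ∑' m : ℕ, (r * L * (lam * mu)) ^ (m + 1) / (m ! * (m + 1)! : ℝ)) := by
  have hr' : (0 : ℝ) < r := hr
  have hp := h.p_pos
  have hs := h.sub_pos
  have hu := h.add_mu_pos
  have hv := h.add_mu_pos'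
  have hfun : expScaleDeriv p mu u v
      = fun x => 1 / p * ((mu + u) / (u - v)) * u * Real.exp (u * x)
        + -(1 / p * ((mu + v) / (u - v)) * v) * Real.exp (v * x) := by
    funext x
    rw [expScaleDeriv]
    ring
  rw [hfun, integral_cutoff_linear hNU _ _ _ (by fun_prop) (by fun_prop),
    integral_cutoff_exp hNU h.lam_pos h.mu_pos hp hr hL hLp hu h.mul_add_mu,
    integral_cutoff_exp hNU h.lam_pos h.mu_pos hp hr hL hLp hv
      (by rw [mul_comm (v + mu)]; exact h.mul_add_mu), add_comm mu u, add_comm mu v]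
  field_simp
  ring

end Model

end ParisianRefracted

end

/-! ### Assembly of the three regimes. -/

theorem mainTheorem10 {Ω : Type*} [MeasurableSpace Ω] (P : Measure Ω) [IsProbabilityMeasure P]
    (p lam mu delta q : ℝ) (r : ℝ≥0)
    (hlam : 0 < lam) (hmu : 0 < mu) (hdelta : 0 < delta) (hp : delta < p) (hr : 0 < r)
    (hq : 0 ≤ q) (hq0 : q = 0 → lam ≠ mu * p ∧ lam ≠ mu * (p - delta))
    (N : ℝ≥0 → Ω → ℕ) (U : ℕ → Ω → ℝ) (hNU : ParisianRefracted.IsClaimModel P lam mu N U) :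
    let X : ℝ≥0 → Ω → ℝ := ParisianRefracted.cramerLundberg p N U
    let Y : ℝ≥0 → Ω → ℝ := ParisianRefracted.subtractDrift X delta
    let W : ℝ → ℝ := ParisianRefracted.scaleFunction (ParisianRefracted.laplaceExponent P X) q
    let WY : ℝ → ℝ := ParisianRefracted.scaleFunction (ParisianRefracted.laplaceExponent P Y) q
    let V : ℝ → ℝ := ParisianRefracted.parisianScale P X delta q r
    let qp : ℝ := ParisianRefracted.rootPos p lam mu q
    let qm : ℝ := ParisianRefracted.rootNeg p lam mu q
    let Ap : ℝ := ParisianRefracted.coefPos p lam mu q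
    let Am : ℝ := ParisianRefracted.coefNeg p lam mu q
    let qpY : ℝ := ParisianRefracted.rootPos (p - delta) lam mu q
    let qmY : ℝ := ParisianRefracted.rootNeg (p - delta) lam mu q
    let ApY : ℝ := ParisianRefracted.coefPos (p - delta) lam mu q
    let AmY : ℝ := ParisianRefracted.coefNeg (p - delta) lam mu q
    let C : ℝ := Real.exp (-lam * r) *
      (p * deriv W (p * r)
        + Am * qp * Real.exp (qp * (p * r)) *
          ∑' m : ℕ, ParisianRefracted.gammaTerm p r (qp + mu) (qm + mu) (p * r) m
        - Ap * qm * Real.exp (qm * (p * r)) *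
          ∑' m : ℕ, ParisianRefracted.gammaTerm p r (qm + mu) (qp + mu) (p * r) m
        + Real.exp (-mu * p * r) / (p * r) *
          ∑' m : ℕ, (p * lam * mu * (r : ℝ) ^ 2) ^ (m + 1) / (m ! * (m + 1)! : ℝ))
    -- the scale functions exist and have the explicit form
    (ParisianRefracted.IsScaleFunction (ParisianRefracted.laplaceExponent P X) q W
      ∧ ParisianRefracted.IsScaleFunction (ParisianRefracted.laplaceExponent P Y) q WY
      ∧ (∀ x : ℝ, 0 ≤ x → W x = 1 / p * (Ap * Real.exp (qp * x) - Am * Real.exp (qm * x)))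
      ∧ (∀ x : ℝ, 0 ≤ x →
          WY x = 1 / (p - delta) * (ApY * Real.exp (qpY * x) - AmY * Real.exp (qmY * x))))
    -- the integrals that define `w` and `V` exist and the series converge
    ∧ (∀ x z : ℝ, 0 ≤ x → 0 < z →
        IntervalIntegrable (fun y => WY (x - y) * deriv W (y + z)) volume 0 x)
    ∧ (∀ x : ℝ, IntegrableOn
        (fun z => ParisianRefracted.refractedScale W WY delta x (-z) * (z / r))
        (Ioi 0) (P.map (X r)))
    ∧ (∀ L : ℝ, 0 ≤ L →
        Summable (ParisianRefracted.gammaTerm p r (qp + mu) (qm + mu) L)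
        ∧ Summable (ParisianRefracted.gammaTerm p r (qm + mu) (qp + mu) L))
    ∧ Summable (fun m : ℕ => (p * lam * mu * (r : ℝ) ^ 2) ^ (m + 1) / (m ! * (m + 1)! : ℝ))
    -- the three regimes
    ∧ (∀ x : ℝ, 0 < x →
        V x = Real.exp (q * r) * (p - delta) * WY x
          - 1 / (mu * lam) * ((q + lam) * WY x - (p - delta) * deriv WY x)
            * ((q + lam) * Real.exp (q * r) - p * C))
    ∧ (∀ x : ℝ, -(p * r) ≤ x → x ≤ 0 →
        V x = Real.exp (-lam * r) *
          (p * W (x + p * r)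
            + Am * Real.exp (qp * (x + p * r)) *
              ∑' m : ℕ, ParisianRefracted.gammaTerm p r (qp + mu) (qm + mu) (p * r + x) m
            - Ap * Real.exp (qm * (x + p * r)) *
              ∑' m : ℕ, ParisianRefracted.gammaTerm p r (qm + mu) (qp + mu) (p * r + x) m))
    ∧ (∀ x : ℝ, x < -(p * r) → V x = 0) := by
  intro X Y W WY V qp qm Ap Am qpY qmY ApY AmY C
  have hr' : (0 : ℝ) < r := hr
  have hp0 : 0 < p := hdelta.trans hp
  have hpr : 0 < p * r := mul_pos hp0 hr'
  have hX : ParisianRefracted.IsRootPair p lam mu q qp qm :=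
    ParisianRefracted.isRootPair hp0 hlam hmu hq fun h => (hq0 h).1
  have hY : ParisianRefracted.IsRootPair (p - delta) lam mu q qpY qmY :=
    ParisianRefracted.isRootPair (sub_pos.2 hp) hlam hmu hq fun h => (hq0 h).2
  have hψX : ∀ θ, 0 ≤ θ → ParisianRefracted.laplaceExponent P X θ
      = p * θ - lam + lam * mu / (θ + mu) := fun θ hθ =>
    ParisianRefracted.laplaceExponent_cramerLundberg hNU hlam.le hmu p hθ
  have hψY : ∀ θ, 0 ≤ θ → ParisianRefracted.laplaceExponent P Y θ
      = (p - delta) * θ - lam + lam * mu / (θ + mu) := fun θ hθ => by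
    simp only [Y, X, ParisianRefracted.subtractDrift_cramerLundberg]
    exact ParisianRefracted.laplaceExponent_cramerLundberg hNU hlam.le hmu (p - delta) hθ
  have hW : W = fun x => if x < 0 then 0 else ParisianRefracted.expScale p mu qp qm x :=
    hX.scaleFunction_eq hψX
  have hWY : WY = fun x => if x < 0 then 0 else
      ParisianRefracted.expScale (p - delta) mu qpY qmY x := hY.scaleFunction_eq hψY
  have hV : ∀ x, V x = ∫ z in Ioi (0 : ℝ),
      ParisianRefracted.refractedScale W WY delta x (-z) * (z / r) ∂(P.map (X r)) := fun _ => rfl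
  have hWx : ∀ x, 0 ≤ x → W x = ParisianRefracted.expScale p mu qp qm x := fun x hx => by
    rw [hW]
    exact if_neg (not_lt.2 hx)
  have hWYx : ∀ x, 0 ≤ x → WY x = ParisianRefracted.expScale (p - delta) mu qpY qmY x :=
    fun x hx => by
      rw [hWY]
      exact if_neg (not_lt.2 hx)
  have hcW : Continuous (ParisianRefracted.expScale p mu qp qm) :=
    ParisianRefracted.IsRootPair.continuous_expScale
  have hcW' := ParisianRefracted.continuous_expScaleDeriv p mu qp qm
  have hneg : ∀ x ≤ 0, EqOn
      (fun z => ParisianRefracted.refractedScale W WY delta x (-z) * (z / r))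
      (ParisianRefracted.cutoff p r (p * r + x) (ParisianRefracted.expScale p mu qp qm))
      (Ioi 0) := fun x hx z _ => by
    simp only [hW]
    exact ParisianRefracted.refractedScale_of_nonpos WY hx
  have hpos : ∀ x, 0 ≤ x → EqOn
      (fun z => ParisianRefracted.refractedScale W WY delta x (-z) * (z / r))
      (ParisianRefracted.cutoff p r (p * r) fun z =>
        ((p - delta) * ParisianRefracted.expScale (p - delta) mu qpY qmY x
          - (q + lam) * ParisianRefracted.expScaleConv (p - delta) qpY qmY x) *
            ParisianRefracted.expScale p mu qp qm z
        + p * ParisianRefracted.expScaleConv (p - delta) qpY qmY x *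
            ParisianRefracted.expScaleDeriv p mu qp qm z)
      (Ioi 0) := fun x hx z hz => by
    simp only [hW, hWY]
    exact ParisianRefracted.refractedScale_mul_eq_cutoff hX hY hx hz
  refine ⟨⟨?_, ?_, hWx, hWYx⟩, ?_, ?_, ?_, ?_, ?_, ?_, ?_⟩
  · rw [hW]
    exact hX.isScaleFunction hψX
  · rw [hWY]
    exact hY.isScaleFunction hψY
  · intro x z hx hz
    have hc : Continuous (ParisianRefracted.expScale (p - delta) mu qpY qmY) :=
      ParisianRefracted.IsRootPair.continuous_expScale
    rw [hW, hWY]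
    refine IntervalIntegrable.congr (f := fun y =>
      ParisianRefracted.expScale (p - delta) mu qpY qmY (x - y) *
        ParisianRefracted.expScaleDeriv p mu qp qm (y + z)) ?_
      (Continuous.intervalIntegrable (by fun_prop) _ _)
    exact fun y hy => (ParisianRefracted.eqOn_refraction_integrand hx hz
      (uIoc_subset_uIcc hy)).symm
  · intro x
    rcases le_total x 0 with hx | hx
    · rw [integrableOn_congr_fun (hneg x hx) measurableSet_Ioi]
      exact ParisianRefracted.integrableOn_cutoff hNU p _ r hcW
    · rw [integrableOn_congr_fun (hpos x hx) measurableSet_Ioi]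
      exact ParisianRefracted.integrableOn_cutoff hNU p _ r (by fun_prop)
  · exact fun L hL => ⟨ParisianRefracted.summable_gammaTerm p r (qm + mu) hX.add_mu_pos.le hL,
      ParisianRefracted.summable_gammaTerm p r (qp + mu) hX.add_mu_pos'.le hL⟩
  · exact ParisianRefracted.summable_besselTerm _
  · intro x hx
    -- `C` is the integral of `W'(z) z / r` against the law of `X_r`: at level `L = p r` the cut-off
    -- is inactive on `z > 0`.
    have hC : C = ∫ z in Ioi 0, ParisianRefracted.cutoff p r (p * r)
        (ParisianRefracted.expScaleDeriv p mu qp qm) z ∂(P.map (X r)) := by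
      rw [ParisianRefracted.integral_cutoff_expScaleDeriv_eq hNU hr hX hpr.le le_rfl]
      simp only [C]
      rw [hW, ParisianRefracted.deriv_ite_expScale hpr, neg_mul,
        show -mu * p * (r : ℝ) = -(mu * (p * r)) by ring,
        show (r : ℝ) * (p * r) * (lam * mu) = p * lam * mu * (r : ℝ) ^ 2 by ring]
      rfl
    have hconv := hY.mul_expScaleConv x
    have hconv' : ParisianRefracted.expScaleConv (p - delta) qpY qmY x
        = 1 / (mu * lam) * ((q + lam) * ParisianRefracted.expScale (p - delta) mu qpY qmY x
          - (p - delta) * ParisianRefracted.expScaleDeriv (p - delta) mu qpY qmY x) := by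
      rw [← hconv]
      field_simp
    have hderiv : deriv WY x = ParisianRefracted.expScaleDeriv (p - delta) mu qpY qmY x := by
      rw [hWY]
      exact ParisianRefracted.deriv_ite_expScale hx
    rw [hV, setIntegral_congr_fun measurableSet_Ioi (hpos x hx.le),
      ParisianRefracted.integral_cutoff_linear hNU _ _ _ hcW hcW', ← hC,
      ParisianRefracted.integral_cutoff_expScale hNU hr hX, hWYx x hx.le, hderiv, ← hconv']
    ring
  · intro x hx hx0
    rw [hV, setIntegral_congr_fun measurableSet_Ioi (hneg x hx0),
      ParisianRefracted.integral_cutoff_expScale_eq hNU hr hX (by linarith) (by linarith),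
      hWx (x + p * r) (by linarith), neg_mul, add_comm x (p * r)]
    rfl
  · intro x hx
    have hx0 : x ≤ 0 := by linarith
    rw [hV, setIntegral_congr_fun measurableSet_Ioi (hneg x hx0)]
    -- Here the level `p r + x` is negative, so `z ≤ p r` puts almost every `z` below the cut-off.
    refine integral_eq_zero_of_ae ?_
    filter_upwards [ae_restrict_of_ae (s := Ioi (0 : ℝ))
      (ParisianRefracted.cramerLundberg_le hNU p r)] with z hz
    rw [ParisianRefracted.cutoff, if_pos (by linarith), zero_mul, Pi.zero_apply]
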